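/- Let $\mathbb{T}^3=\mathbb{R}^3/\mathbb{Z}^3$ and $T>0$. Let $h\in C_{\mathrm{weak}}([0,T];L^2(\mathbb{T}^3;\mathbb{R}^3))$ be a weak solution of the inviscid electron MHD (E-MHD) equations $$h_t+\nabla\times\big[(\nabla\times h)\times h\big]=0,\qquad \operatorname{div}h=0,$$ that is, $\operatorname{div}h(t)=0$ in the sense of distributions for every $t\in[0,T]$, and $$\int_0^T\!\!\int_{\mathbb{T}^3}\big(h\cdot\partial_t\varphi+(h\otimes h):\nabla(\nabla\times\varphi)\big)\,dx\,dt=0$$ for every divergence-free vector field $\varphi\in C_0^\infty((0,T)\times\mathbb{T}^3;\mathbb{R}^3)$. Assume that $h(0)$ has zero mean over $\mathbb{T}^3$, and that $\vec{j}=\operatorname{curl}h\in C([0,T];L^{3/2}(\mathbb{T}^3))$. Assume moreover that $h\in L^3(0,T;\underline{B}^{1/3}_{3,VMO}(\mathbb{T}^3))$, that is, $h$ is measurable on $(0,T)\times\mathbb{T}^3$, $\int_0^T\|h(t)\|_{L^3(\mathbb{T}^3)}^3\,dt<\infty$ and $$\lim_{\varepsilon\to0^+}\frac1{\varepsilon^{1/3}}\left(\int_0^T\int_{\mathbb{T}^3}\frac{1}{|B_\varepsilon(0)|}\int_{B_\varepsilon(0)}|h(x,t)-h(x-y,t)|^3\,dy\,dx\,dt\right)^{1/3}=0,$$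 where $B_\varepsilon(0)\subset\mathbb{R}^3$ is the ball of radius $\varepsilon$ about $0$. Then for every $t\in[0,T]$ the magnetic vector potential $H(t)=\operatorname{curl}^{-1}h(t)$ exists, i.e. there is a divergence-free field $H(t)\in L^2(\mathbb{T}^3;\mathbb{R}^3)$ of zero mean with $\operatorname{curl}H(t)=h(t)$ in the sense of distributions. For every $t\in[0,T]$, the function $H(t)\cdot\operatorname{curl}H(t)$ is integrable and the magnetic helicity is conserved: $$\int_{\mathbb{T}^3}H(t)\cdot\operatorname{curl}H(t)\,dx=\int_{\mathbb{T}^3}H(0)\cdot\operatorname{curl}H(0)\,dx .$$ -/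

import Mathlib

open MeasureTheory Set Filter Topology

noncomputable section

namespace EMHD

/-- The flat torus `ℝ³ / ℤ³`, carrying its Haar probability measure `volume`. -/
abbrev T3 : Type := UnitAddTorus (Fin 3)

/-- Euclidean three-space. -/
abbrev E3 : Type := EuclideanSpace ℝ (Fin 3)

/-- The quotient map `ℝ³ → ℝ³ / ℤ³`. -/
def toTorus (y : E3) : T3 := fun i => ((y i : ℝ) : UnitAddCircle)

/-- The classical partial derivative `∂ᵢ f` of a function on the torus. -/
def partialDeriv (i : Fin 3) (f : T3 → ℝ) (x : T3) : ℝ :=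
  deriv (fun s : ℝ => f (x + toTorus (EuclideanSpace.single i s))) 0

/-- The classical gradient. -/
def gradient (f : T3 → ℝ) (x : T3) : E3 :=
  !₂[partialDeriv 0 f x, partialDeriv 1 f x, partialDeriv 2 f x]

/-- The classical divergence. -/
def divergence (φ : T3 → E3) (x : T3) : ℝ :=
  ∑ i, partialDeriv i (fun z => φ z i) x

/-- The classical curl. -/
def curl (φ : T3 → E3) (x : T3) : E3 :=
  !₂[partialDeriv 1 (fun z => φ z 2) x - partialDeriv 2 (fun z => φ z 1) x,
     partialDeriv 2 (fun z => φ z 0) x - partialDeriv 0 (fun z => φ z 2) x,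
     partialDeriv 0 (fun z => φ z 1) x - partialDeriv 1 (fun z => φ z 0) x]

/-- Smoothness of a function on the torus: its periodic lift to `ℝ³` is `C^∞`. -/
def IsSmooth {F : Type*} [NormedAddCommGroup F] [NormedSpace ℝ F] (φ : T3 → F) : Prop :=
  ContDiff ℝ ((⊤ : ℕ∞) : WithTop ℕ∞) (fun y : E3 => φ (toTorus y))

/-- `div u = 0` in the sense of distributions, for `u ∈ L¹`. -/
def IsWeaklyDivFree (u : T3 → E3) : Prop :=
  Integrable u volume ∧
    ∀ ψ : T3 → ℝ, IsSmooth ψ → ∫ x, inner ℝ (u x) (gradient ψ x) = 0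

/-- `curl u = w` in the sense of distributions, for `u, w ∈ L¹`. -/
def IsWeakCurl (u w : T3 → E3) : Prop :=
  Integrable u volume ∧ Integrable w volume ∧
    ∀ φ : T3 → E3, IsSmooth φ → ∫ x, inner ℝ (w x) (φ x) = ∫ x, inner ℝ (u x) (curl φ x)

/-- `H = curl⁻¹ h`: `H` is the (almost everywhere unique) square integrable, divergence-free
field of zero mean whose distributional curl is `h`. -/
structure IsCurlInv (H h : T3 → E3) : Prop where
  memLp : MemLp H 2 volume
  divFree : IsWeaklyDivFree H
  curl_eq : IsWeakCurl H h
  mean_zero : ∫ x, H x = 0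

/-- Divergence-free test vector fields in `C_0^∞((0,T) × 𝕋³)`. -/
structure IsTestField (T : ℝ) (φ : ℝ → T3 → E3) : Prop where
  smooth : ContDiff ℝ ((⊤ : ℕ∞) : WithTop ℕ∞) (fun p : ℝ × E3 => φ p.1 (toTorus p.2))
  support : ∃ a b : ℝ, 0 < a ∧ b < T ∧ ∀ t, t ∉ Icc a b → ∀ x, φ t x = 0
  divFree : ∀ t x, divergence (φ t) x = 0

/-- `h ∈ C_weak([0,T]; L²(𝕋³))` is a weak solution of the inviscid electron MHD equations
`h_t + ∇ × ((∇ × h) × h) = 0`, `div h = 0`, the Hall term being read, as is usual for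
divergence-free `h`, as `∇ × div (h ⊗ h)`. The initial datum is `h 0`. -/
structure IsWeakSolution (T : ℝ) (h : ℝ → T3 → E3) : Prop where
  memLp : ∀ t ∈ Icc 0 T, MemLp (h t) 2 volume
  weakCont : ∀ w : T3 → E3, MemLp w 2 volume →
    ContinuousOn (fun t => ∫ x, inner ℝ (h t x) (w x)) (Icc 0 T)
  divFree : ∀ t ∈ Icc 0 T, IsWeaklyDivFree (h t)
  equation : ∀ φ : ℝ → T3 → E3, IsTestField T φ →
    ∫ t in Ioo 0 T, ∫ x,
      (inner ℝ (h t x) (deriv (fun s => φ s x) t)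
        + ∑ i, ∑ k, h t x i * h t x k * partialDeriv i (fun z => curl (φ t) z k) x) = 0

/-- `f ∈ C([0,T]; L^p(𝕋³))`. -/
def IsContinuousInLp (T : ℝ) (p : ENNReal) (f : ℝ → T3 → E3) : Prop :=
  (∀ t ∈ Icc 0 T, MemLp (f t) p volume) ∧
    ∀ t₀ ∈ Icc 0 T,
      Tendsto (fun t => eLpNorm (f t - f t₀) p volume) (𝓝[Icc 0 T] t₀) (𝓝 0)

/-- The averaged modulus of continuity
`(∫₀ᵀ [∫_{𝕋³} ⨍_{B_ε(0)} |f(x) - f(x - y)|^q dy dx]^{p/q} dt)^{1/p}`. -/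
def vmoModulus (T p q : ℝ) (f : ℝ → T3 → E3) (ε : ℝ) : ENNReal :=
  (∫⁻ t in Ioo 0 T,
    (∫⁻ x, laverage (volume.restrict (Metric.ball (0 : E3) ε))
      (fun y => ‖f t x - f t (x - toTorus y)‖ₑ ^ q)) ^ (p / q))
      ^ (1 / p)

/-- `f ∈ L^p(0,T; B̲^α_{q,VMO}(𝕋³))`, for finite exponents `p`, `q`. -/
structure MemLpBesovVMO (T p α q : ℝ) (f : ℝ → T3 → E3) : Prop where
  measurable : AEStronglyMeasurable (fun z : ℝ × T3 => f z.1 z.2)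
    ((volume.restrict (Ioo 0 T)).prod volume)
  norm_lt_top : ∫⁻ t in Ioo 0 T, (∫⁻ x, ‖f t x‖ₑ ^ q) ^ (p / q) < ⊤
  vmo : Tendsto (fun ε : ℝ => ENNReal.ofReal (1 / ε ^ α) * vmoModulus T p q f ε)
    (𝓝[>] 0) (𝓝 0)

end EMHD

end

/-! The helicity is the quadratic form of a symmetric bilinear form, because `curl` is formally
self-adjoint. For an even mollifier `K` put B(a,b) = ∫ h(a) · K∗H(b). Since `curl H = h` and `K` is
even, B(a,b) = B(b,a) (`IsCurlInv.integral_inner_vconv_comm`), and therefore B(b,b) - B(a,a) =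
[B(b,b) - B(a,b)] + [B(b,a) - B(a,a)]. In each bracket the smooth divergence-free field K∗H is
frozen in time, so a test field χ(t) K∗H(s) is admissible and no time regularity of `H` is needed.
As curl (K∗H) = K∗h, each bracket is a time integral of the flux ∫ u ⊗ u : ∇(K∗v) with u = h(r) and
v = h(a) or h(b) (`IsWeakSolution.integral_sub_integral`). Summing over a fine partition of [0,t]
puts the frozen time on the diagonal (`sub_eq_integral_diagonal`), and the mollified helicity
changes by ∫ 2 flux(h(r),h(r)) dr (`IsWeakSolution.mollified_helicity_sub`).

It remains to make the flux vanish with the mollification scale ε. For divergence-free `u` it equals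
-1/4 of ∫∫ ∇K(y) · δu |δu|², with δu = u(x) - u(x - y) (`IsKernel.integral_increment`), an identity
of the kind behind the 4/3 law of turbulence. The gradient of the rescaled kernel has size ε⁻⁴ on a
ball of volume of order ε³, so the time-integrated flux is at most a constant times ε⁻¹ times the
cubed averaged modulus. Since ε⁻¹ = (ε^(-1/3))³, the VMO condition at exponent 1/3 is exactly what
sends this to zero (`IsWeakSolution.enorm_integral_flux_le`). On the other side the mollified
helicities converge to the true ones, by continuity of translations in L².

The potential itself comes from the Fourier multiplier i n × · / (2π|n|²) (`exists_isCurlInv`). It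
requires zero mean at every time, and the mean is conserved: this is the weak equation tested
against constant, hence curl-free, fields. -/

noncomputable section

namespace EMHD

/-! ### The torus as a quotient of space, and measure-preserving shears. -/

section Torus

lemma toTorus_add (y z : E3) : toTorus (y + z) = toTorus y + toTorus z := by
  ext i; simp [toTorus]

lemma toTorus_neg (y : E3) : toTorus (-y) = -toTorus y := by
  ext i; simp [toTorus]

lemma toTorus_sub (y z : E3) : toTorus (y - z) = toTorus y - toTorus z := by
  ext i; simp [toTorus]

@[simp] lemma toTorus_zero : toTorus 0 = 0 := by
  ext i; simp [toTorus]

lemma isOpenQuotientMap_toTorus : IsOpenQuotientMap toTorus := by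
  have h1 : IsOpenQuotientMap (Pi.map (fun (_ : Fin 3) (t : ℝ) => (t : UnitAddCircle))) :=
    IsOpenQuotientMap.piMap fun _ => QuotientAddGroup.isOpenQuotientMap_mk
  exact h1.comp (PiLp.homeomorph 2 (fun _ : Fin 3 => ℝ)).isOpenQuotientMap

@[fun_prop] lemma continuous_toTorus : Continuous toTorus := isOpenQuotientMap_toTorus.continuous

lemma toTorus_surjective : Function.Surjective toTorus := isOpenQuotientMap_toTorus.surjective

@[fun_prop] lemma measurable_toTorus : Measurable toTorus :=
  continuous_toTorus.measurable

lemma toTorus_single_one (i : Fin 3) : toTorus (EuclideanSpace.single i 1) = 0 := by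
  ext j
  by_cases h : j = i
  · subst h
    simp [toTorus]
  · simp [toTorus, h]

instance : IsProbabilityMeasure (volume : Measure UnitAddCircle) :=
  ⟨UnitAddCircle.measure_univ⟩

instance : IsProbabilityMeasure (volume : Measure T3) := by
  change IsProbabilityMeasure (Measure.pi fun _ => (volume : Measure UnitAddCircle))
  infer_instance

instance : (volume : Measure T3).IsAddHaarMeasure := by
  change (Measure.pi fun _ => (volume : Measure UnitAddCircle)).IsAddHaarMeasure
  infer_instance

/-- The half-open unit cube with lower corner `a`. -/
def cube (a : E3) : Set E3 := {y | ∀ i, y i ∈ Ioc (a i) (a i + 1)}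

lemma measurePreserving_toTorus (a : E3) :
    MeasurePreserving toTorus (volume.restrict (cube a)) volume := by
  have h1 : MeasurePreserving (fun (y : Fin 3 → ℝ) (i : Fin 3) => ((y i : ℝ) : UnitAddCircle))
      (Measure.pi fun i => volume.restrict (Ioc (a i) (a i + 1))) volume :=
    measurePreserving_pi _ _ fun i => UnitAddCircle.measurePreserving_mk (a i)
  rw [← Measure.restrict_pi_pi] at h1
  have h2 : MeasurePreserving (WithLp.ofLp : E3 → Fin 3 → ℝ) volume volume :=
    PiLp.volume_preserving_ofLp (Fin 3)
  have h3 := h2.restrict_preimage (s := univ.pi fun i => Ioc (a i) (a i + 1))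
    (MeasurableSet.univ_pi fun _ => measurableSet_Ioc)
  have h4 : (WithLp.ofLp : E3 → Fin 3 → ℝ) ⁻¹' (univ.pi fun i => Ioc (a i) (a i + 1)) = cube a := by
    ext y; simp [cube]
  rw [h4] at h3
  exact h1.comp h3

lemma cube_mem_nhds (z : E3) : cube (z - !₂[1/2, 1/2, 1/2]) ∈ 𝓝 z := by
  have : {y : E3 | ∀ i, y i ∈ Ioo (z i - 1/2) (z i + 1/2)} ∈ 𝓝 z := by
    have ho : IsOpen {y : E3 | ∀ i, y i ∈ Ioo (z i - 1/2) (z i + 1/2)} := by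
      simp only [ofPred_forall]
      exact isOpen_iInter_of_finite fun i => isOpen_Ioo.preimage (by fun_prop)
    exact ho.mem_nhds fun i => ⟨by linarith, by linarith⟩
  filter_upwards [this] with y hy i
  have := hy i
  fin_cases i <;> simp at this ⊢ <;> constructor <;> linarith

/-- Every point is interior to a unit cube, on which the quotient map preserves measure. This gives
access to the convolution theory of Euclidean space. -/
lemma locallyIntegrable_lift {F : Type*} [NormedAddCommGroup F] {f : T3 → F}
    (hf : Integrable f volume) : LocallyIntegrable (fun y : E3 => f (toTorus y)) volume := by
  intro z
  exact ⟨_, cube_mem_nhds z, (measurePreserving_toTorus _).integrable_comp_of_integrable hf⟩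

/-- The shear `(x, y) ↦ (x - y mod ℤ³, y)` preserves the product measure. -/
lemma measurePreserving_shear (ν : Measure E3) [SFinite ν] :
    MeasurePreserving (fun p : T3 × E3 => (p.1 - toTorus p.2, p.2))
      (volume.prod ν) (volume.prod ν) := by
  have h : MeasurePreserving (fun p : E3 × T3 => (p.1, p.2 - toTorus p.1))
      (ν.prod volume) (ν.prod volume) :=
    (MeasurePreserving.id ν).skew_product (g := fun y x => x - toTorus y) (by fun_prop)
      (ae_of_all _ fun y => (measurePreserving_sub_right volume (toTorus y)).map_eq)
  exact (Measure.measurePreserving_swap.comp h).comp Measure.measurePreserving_swap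

/-- The involution `(x, y) ↦ (x - y mod ℤ³, -y)` preserves the product measure. -/
lemma measurePreserving_reflection :
    MeasurePreserving (fun p : T3 × E3 => (p.1 - toTorus p.2, -p.2))
      (volume.prod volume) (volume.prod volume) :=
  ((MeasurePreserving.id volume).prod (Measure.measurePreserving_neg volume)).comp
    (measurePreserving_shear volume)

end Torus

/-! ### Calculus of smooth functions on the torus. -/

section Smooth

lemma single_eq_smul (i : Fin 3) (s : ℝ) :
    (EuclideanSpace.single i s : E3) = s • EuclideanSpace.single i (1 : ℝ) := by
  ext j; by_cases h : j = i <;> simp [h]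

@[simp] lemma single_zero (i : Fin 3) : (EuclideanSpace.single i (0 : ℝ) : E3) = 0 := by
  rw [single_eq_smul, zero_smul]

lemma continuous_toTorus_single (i : Fin 3) :
    Continuous fun s : ℝ => toTorus (EuclideanSpace.single i s) := by
  have : Continuous fun s : ℝ => (EuclideanSpace.single i s : E3) := by
    rw [funext (single_eq_smul i)]; fun_prop
  fun_prop

variable {F : Type*} [NormedAddCommGroup F] [NormedSpace ℝ F]

lemma IsSmooth.continuous {f : T3 → F} (hf : IsSmooth f) : Continuous f :=
  isOpenQuotientMap_toTorus.continuous_comp_iff.1 (ContDiff.continuous hf)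

lemma IsSmooth.exists_bound {f : T3 → F} (hf : IsSmooth f) : ∃ C, ∀ x, ‖f x‖ ≤ C :=
  let ⟨C, hC⟩ := isCompact_univ.exists_bound_of_continuousOn hf.continuous.continuousOn
  ⟨C, fun x => hC x (mem_univ x)⟩

lemma IsSmooth.memLp {f : T3 → F} (hf : IsSmooth f) (p : ENNReal) : MemLp f p volume :=
  let ⟨C, hC⟩ := hf.exists_bound
  MemLp.of_bound hf.continuous.aestronglyMeasurable C (ae_of_all _ hC)

lemma IsSmooth.integrable {f : T3 → F} (hf : IsSmooth f) : Integrable f volume :=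
  memLp_one_iff_integrable.1 (hf.memLp 1)

lemma isSmooth_const (c : F) : IsSmooth (fun _ : T3 => c) := contDiff_const

lemma IsSmooth.sub {f g : T3 → F} (hf : IsSmooth f) (hg : IsSmooth g) :
    IsSmooth fun x => f x - g x := ContDiff.sub hf hg

lemma IsSmooth.mul {f g : T3 → ℝ} (hf : IsSmooth f) (hg : IsSmooth g) :
    IsSmooth fun x => f x * g x := ContDiff.mul hf hg

lemma IsSmooth.sum {ι : Type*} {s : Finset ι} {f : ι → T3 → F} (hf : ∀ i ∈ s, IsSmooth (f i)) :
    IsSmooth fun x => ∑ i ∈ s, f i x := ContDiff.sum hf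

lemma IsSmooth.comp_sub {f : T3 → F} (hf : IsSmooth f) (a : T3) : IsSmooth fun x => f (x - a) := by
  obtain ⟨y, rfl⟩ := toTorus_surjective a
  have : ContDiff ℝ ((⊤ : ℕ∞) : WithTop ℕ∞) fun z : E3 => f (toTorus (z - y)) :=
    ContDiff.comp (g := fun z : E3 => f (toTorus z)) hf (contDiff_id.sub contDiff_const)
  simpa only [IsSmooth, toTorus_sub] using this

lemma isSmooth_iff {f : T3 → E3} : IsSmooth f ↔ ∀ i, IsSmooth fun x => f x i :=
  contDiff_euclidean

variable {f g : T3 → ℝ} (i : Fin 3)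

lemma hasDerivAt_line (hf : Differentiable ℝ fun y : E3 => f (toTorus y)) (z : E3) (s : ℝ) :
    HasDerivAt (fun s => f (toTorus z + toTorus (EuclideanSpace.single i s)))
      (fderiv ℝ (fun y : E3 => f (toTorus y)) (z + EuclideanSpace.single i s)
        (EuclideanSpace.single i 1)) s := by
  have h1 : HasDerivAt (fun s : ℝ => z + s • (EuclideanSpace.single i (1 : ℝ) : E3))
      ((1 : ℝ) • EuclideanSpace.single i (1 : ℝ)) s :=
    ((hasDerivAt_id s).smul_const _).const_add z
  have h := (hf (z + EuclideanSpace.single i s)).hasFDerivAt.comp_hasDerivAt_of_eq s h1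
    (by rw [single_eq_smul])
  rw [one_smul] at h
  refine h.congr_of_eventuallyEq (Eventually.of_forall fun s => ?_)
  simp only [Function.comp, toTorus_add, single_eq_smul i s]

lemma partialDeriv_toTorus (hf : Differentiable ℝ fun y : E3 => f (toTorus y)) (z : E3) :
    partialDeriv i f (toTorus z)
      = fderiv ℝ (fun y : E3 => f (toTorus y)) z (EuclideanSpace.single i 1) := by
  simpa [partialDeriv] using (hasDerivAt_line i hf z 0).deriv

lemma IsSmooth.differentiable (hf : IsSmooth f) : Differentiable ℝ fun y : E3 => f (toTorus y) :=
  ContDiff.differentiable hf (by simp)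

lemma IsSmooth.partialDeriv (hf : IsSmooth f) : IsSmooth (partialDeriv i f) := by
  have h : ContDiff ℝ ((⊤ : ℕ∞) : WithTop ℕ∞) fun z : E3 =>
      fderiv ℝ (fun y : E3 => f (toTorus y)) z (EuclideanSpace.single i 1) :=
    (ContDiff.fderiv_right hf (by simp)).clm_apply contDiff_const
  simpa only [IsSmooth, partialDeriv_toTorus i hf.differentiable] using h

lemma IsSmooth.hasDerivAt (hf : IsSmooth f) (x : T3) (s : ℝ) :
    HasDerivAt (fun s => f (x + toTorus (EuclideanSpace.single i s)))
      (EMHD.partialDeriv i f (x + toTorus (EuclideanSpace.single i s))) s := by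
  obtain ⟨z, rfl⟩ := toTorus_surjective x
  rw [← toTorus_add, partialDeriv_toTorus i hf.differentiable]
  exact hasDerivAt_line i hf.differentiable z s

lemma IsSmooth.hasDerivAt_zero (hf : IsSmooth f) (x : T3) :
    HasDerivAt (fun s => f (x + toTorus (EuclideanSpace.single i s)))
      (EMHD.partialDeriv i f x) 0 := by
  simpa using hf.hasDerivAt i x 0

lemma partialDeriv_mul (hf : IsSmooth f) (hg : IsSmooth g) (x : T3) :
    partialDeriv i (fun z => f z * g z) x
      = partialDeriv i f x * g x + f x * partialDeriv i g x := by
  have := ((hf.hasDerivAt_zero i x).mul (hg.hasDerivAt_zero i x)).deriv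
  simp only [single_zero, toTorus_zero, add_zero] at this
  exact this

lemma partialDeriv_const_mul (c : ℝ) (f : T3 → ℝ) (x : T3) :
    partialDeriv i (fun z => c * f z) x = c * partialDeriv i f x := by
  simp [partialDeriv]

lemma partialDeriv_comp_sub (f : T3 → ℝ) (a x : T3) :
    partialDeriv i (fun z => f (z - a)) x = partialDeriv i f (x - a) := by
  simp only [partialDeriv, add_sub_right_comm]

@[simp] lemma partialDeriv_const (c : ℝ) (x : T3) : partialDeriv i (fun _ => c) x = 0 := by
  simp [partialDeriv]

/-- By translation invariance the integrand may be averaged over a full period in direction `i`.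
After Fubini the inner integral is the difference of `f` at two points that coincide on the torus.
-/
lemma integral_partialDeriv (hf : IsSmooth f) : ∫ x, partialDeriv i f x = 0 := by
  obtain ⟨C, hC⟩ := (hf.partialDeriv i).exists_bound
  have hc := (hf.partialDeriv i).continuous
  have hcs := continuous_toTorus_single i
  have key : ∀ x, ∫ s in (0:ℝ)..1, partialDeriv i f (x + toTorus (EuclideanSpace.single i s)) = 0 := by
    intro x
    rw [intervalIntegral.integral_eq_sub_of_hasDerivAt (fun s _ => hf.hasDerivAt i x s)]
    · rw [toTorus_single_one]; simp
    · exact (hc.comp (continuous_const.add hcs)).intervalIntegrable _ _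
  calc ∫ x, partialDeriv i f x
      = ∫ s in (0:ℝ)..1, ∫ x, partialDeriv i f (x + toTorus (EuclideanSpace.single i s)) := by
        simp_rw [integral_add_right_eq_self]; simp
    _ = ∫ x, ∫ s in (0:ℝ)..1, partialDeriv i f (x + toTorus (EuclideanSpace.single i s)) := by
        simp_rw [intervalIntegral.integral_of_le zero_le_one]
        rw [integral_integral_swap]
        refine Integrable.of_bound ?_ C (ae_of_all _ fun p => hC _)
        refine Continuous.aestronglyMeasurable ?_
        exact hc.comp (continuous_snd.add (hcs.comp continuous_fst))
    _ = 0 := by simp [key]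

/-- Integration by parts on the torus. -/
lemma integral_mul_partialDeriv (hf : IsSmooth f) (hg : IsSmooth g) :
    ∫ x, f x * partialDeriv i g x = -∫ x, partialDeriv i f x * g x := by
  have h := integral_partialDeriv i (hf.mul hg)
  simp_rw [partialDeriv_mul i hf hg] at h
  rw [integral_add (((hf.partialDeriv i).mul hg).integrable)
    ((hf.mul (hg.partialDeriv i)).integrable)] at h
  linarith

end Smooth

/-! ### Convolution of torus functions with kernels on Euclidean space. -/

section Conv

/-- Convolution of a function on the torus with a kernel on `ℝ³`. -/
def conv (K : E3 → ℝ) (f : T3 → ℝ) (x : T3) : ℝ := ∫ y, K y * f (x - toTorus y)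

/-- The componentwise convolution of a vector field with a kernel. -/
def vconv (K : E3 → ℝ) (u : T3 → E3) (x : T3) : E3 :=
  WithLp.toLp 2 fun k => conv K (fun z => u z k) x

@[simp] lemma vconv_apply (K : E3 → ℝ) (u : T3 → E3) (x : T3) (k : Fin 3) :
    vconv K u x k = conv K (fun z => u z k) x := rfl

/-- A smooth compactly supported function on `ℝ³`. -/
structure IsKernel (K : E3 → ℝ) : Prop where
  smooth : ContDiff ℝ ((⊤ : ℕ∞) : WithTop ℕ∞) K
  compact : HasCompactSupport K

/-- The `i`-th partial derivative of a kernel. -/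
def kernelDeriv (i : Fin 3) (K : E3 → ℝ) (y : E3) : ℝ := fderiv ℝ K y (EuclideanSpace.single i 1)

lemma IsKernel.continuous {K : E3 → ℝ} (hK : IsKernel K) : Continuous K := hK.smooth.continuous

lemma IsKernel.kernelDeriv {K : E3 → ℝ} (hK : IsKernel K) (i : Fin 3) :
    IsKernel (kernelDeriv i K) where
  smooth := (hK.smooth.fderiv_right (by simp)).clm_apply contDiff_const
  compact := (hK.compact.fderiv ℝ).comp_left (g := fun L : E3 →L[ℝ] ℝ => L _) (by simp)

lemma conv_toTorus (K : E3 → ℝ) (f : T3 → ℝ) (z : E3) :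
    conv K f (toTorus z)
      = convolution K (fun y => f (toTorus y)) (ContinuousLinearMap.mul ℝ ℝ) volume z := by
  simp [conv, convolution, toTorus_sub]

variable {K : E3 → ℝ} {f g : T3 → ℝ}

lemma IsKernel.isSmooth_conv (hK : IsKernel K) (hf : Integrable f volume) :
    IsSmooth (conv K f) := by
  have := hK.compact.contDiff_convolution_left (ContinuousLinearMap.mul ℝ ℝ) hK.smooth
    (locallyIntegrable_lift hf)
  simpa only [IsSmooth, conv_toTorus] using this

lemma IsKernel.partialDeriv_conv (hK : IsKernel K) (hf : Integrable f volume) (i : Fin 3) (x : T3) :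
    partialDeriv i (conv K f) x = conv (EMHD.kernelDeriv i K) f x := by
  obtain ⟨z, rfl⟩ := toTorus_surjective x
  rw [partialDeriv_toTorus i (hK.isSmooth_conv hf).differentiable]
  simp_rw [conv_toTorus]
  have hl := locallyIntegrable_lift hf
  rw [(hK.compact.hasFDerivAt_convolution_left (ContinuousLinearMap.mul ℝ ℝ)
    (hK.smooth.of_le (by simp)) hl z).fderiv]
  have hex := (hK.compact.fderiv ℝ).convolutionExists_left
    ((ContinuousLinearMap.mul ℝ ℝ).precompL E3) (hK.smooth.continuous_fderiv (by simp)) hl z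
  rw [convolution, ContinuousLinearMap.integral_apply hex]
  rfl

lemma IsKernel.vconv_smooth (hK : IsKernel K) {u : T3 → E3} (hu : Integrable u volume) :
    IsSmooth (vconv K u) :=
  isSmooth_iff.2 fun i => hK.isSmooth_conv (hu.eval_piLp i)

/-- Only the support of `K` matters, and its measure is finite. There the shear preserves the `L^q`
norm of the translated factor, so Hölder applies. This justifies every later use of Fubini. -/
lemma integrable_prod_shear (hK : Continuous K) (hc : HasCompactSupport K) {p q : ENNReal}
    [ENNReal.HolderTriple p q 1] (hf : MemLp f p volume) (hg : MemLp g q volume) :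
    Integrable (fun z : T3 × E3 => K z.2 * (f z.1 * g (z.1 - toTorus z.2)))
      (volume.prod volume) := by
  obtain ⟨C, hC⟩ := hc.exists_bound_of_continuous hK
  set S : Set E3 := tsupport K
  have hS : IsCompact S := hc
  have : IsFiniteMeasure (volume.restrict S) := ⟨by simpa using hS.measure_lt_top⟩
  rw [← integrableOn_iff_integrable_of_support_subset (s := univ ×ˢ S), IntegrableOn,
    ← Measure.prod_restrict, Measure.restrict_univ]
  · have h1 : MemLp (fun z : T3 × E3 => f z.1) p (volume.prod (volume.restrict S)) :=
      hf.comp_fst _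
    have h2 : MemLp (fun z : T3 × E3 => g (z.1 - toTorus z.2)) q
        (volume.prod (volume.restrict S)) :=
      (hg.comp_fst (volume.restrict S)).comp_measurePreserving
        (measurePreserving_shear (volume.restrict S))
    have h3 := memLp_one_iff_integrable.1 (h2.mul (r := 1) h1)
    exact h3.bdd_mul (c := C) (hK.comp continuous_snd).aestronglyMeasurable
      (ae_of_all _ fun z => hC _)
  · intro z hz
    refine ⟨mem_univ _, subset_tsupport _ ?_⟩
    intro h0
    exact hz (by simp [h0])

lemma integral_prod_shear (hK : Continuous K) (hc : HasCompactSupport K) {p q : ENNReal}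
    [ENNReal.HolderTriple p q 1] (hf : MemLp f p volume) (hg : MemLp g q volume) :
    ∫ z : T3 × E3, K z.2 * (f z.1 * g (z.1 - toTorus z.2)) ∂(volume.prod volume)
      = ∫ x, f x * conv K g x := by
  rw [integral_prod _ (integrable_prod_shear hK hc hf hg)]
  refine integral_congr_ae (ae_of_all _ fun x => ?_)
  simp only [conv]
  rw [← integral_const_mul]
  congr 1; funext y; ring

lemma integral_mul_conv_eq (hK : Continuous K) (hc : HasCompactSupport K) {p q : ENNReal}
    [ENNReal.HolderTriple p q 1] (hf : MemLp f p volume) (hg : MemLp g q volume) :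
    ∫ x, f x * conv K g x = ∫ y, K y * ∫ x, f x * g (x - toTorus y) := by
  rw [← integral_prod_shear hK hc hf hg,
    integral_prod_symm _ (integrable_prod_shear hK hc hf hg)]
  simp_rw [integral_const_mul]

lemma integral_mul_shift (f g : T3 → ℝ) (a : T3) :
    ∫ x, f x * g (x - a) = ∫ x, f (x - -a) * g x := by
  rw [← integral_add_right_eq_self _ a]
  simp

/-- Convolution with an even kernel is symmetric. -/
lemma integral_mul_conv_comm (hK : Continuous K) (hc : HasCompactSupport K)
    (he : ∀ y, K (-y) = K y) {p q : ENNReal}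
    [ENNReal.HolderTriple p q 1] (hf : MemLp f p volume) (hg : MemLp g q volume) :
    ∫ x, f x * conv K g x = ∫ x, conv K f x * g x := by
  have : ENNReal.HolderTriple q p 1 := ENNReal.HolderTriple.symm
  simp_rw [mul_comm (conv K f _)]
  rw [integral_mul_conv_eq hK hc hf hg, integral_mul_conv_eq hK hc hg hf,
    ← integral_neg_eq_self]
  refine integral_congr_ae (ae_of_all _ fun y => ?_)
  simp only [he, integral_mul_shift f g, toTorus_neg, neg_neg]
  congr 2; funext x; ring

lemma IsKernel.integrable_mul_conv (hK : IsKernel K) (hf : Integrable f volume)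
    (hg : Integrable g volume) : Integrable (fun x => f x * conv K g x) volume := by
  obtain ⟨C, hC⟩ := (hK.isSmooth_conv hg).exists_bound
  exact hf.mul_bdd (hK.isSmooth_conv hg).continuous.aestronglyMeasurable (ae_of_all _ hC)

lemma Integrable.mul_isSmooth (hf : Integrable f volume) (hg : IsSmooth g) :
    Integrable (fun x => f x * g x) volume := by
  obtain ⟨C, hC⟩ := hg.exists_bound
  exact hf.mul_bdd hg.continuous.aestronglyMeasurable (ae_of_all _ hC)

lemma Integrable.isSmooth_mul (hf : Integrable f volume) (hg : IsSmooth g) :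
    Integrable (fun x => g x * f x) volume := by
  simpa only [mul_comm] using Integrable.mul_isSmooth hf hg

lemma eq_zero_of_forall_integral_mul_eq_zero (hg : IsSmooth g)
    (h : ∀ ψ : T3 → ℝ, IsSmooth ψ → ∫ x, g x * ψ x = 0) : g = 0 := by
  have h0 := h g hg
  have h1 : (fun x => g x * g x) =ᵐ[volume] 0 :=
    (integral_eq_zero_iff_of_nonneg (fun x => mul_self_nonneg _) (hg.mul hg).integrable).1 h0
  have h2 := (Continuous.ae_eq_iff_eq volume (hg.mul hg).continuous continuous_zero).1 h1
  funext x
  exact mul_self_eq_zero.1 (congrFun h2 x)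

end Conv

/-! ### Mollification turns weak differential identities into classical ones. -/

section WeakDiff

variable {K : E3 → ℝ} {u w : T3 → E3}

lemma gradient_apply (f : T3 → ℝ) (x : T3) (i : Fin 3) :
    gradient f x i = partialDeriv i f x := by
  fin_cases i <;> rfl

lemma curl_apply (φ : T3 → E3) (x : T3) (k : Fin 3) :
    curl φ x k = partialDeriv (k + 1) (fun z => φ z (k + 2)) x
      - partialDeriv (k + 2) (fun z => φ z (k + 1)) x := by
  fin_cases k <;> rfl

lemma inner_eq_sum (a b : E3) : inner ℝ a b = ∑ i, a i * b i := by
  simp [PiLp.inner_apply, mul_comm]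

lemma IsSmooth.curl {φ : T3 → E3} (hφ : IsSmooth φ) : IsSmooth (curl φ) := by
  rw [isSmooth_iff] at hφ ⊢
  intro k
  simp_rw [curl_apply]
  exact ((hφ _).partialDeriv _).sub ((hφ _).partialDeriv _)

lemma IsWeaklyDivFree.sum_integral (hu : IsWeaklyDivFree u) {ψ : T3 → ℝ} (hψ : IsSmooth ψ) :
    ∑ i, ∫ x, u x i * partialDeriv i ψ x = 0 := by
  rw [← integral_finsetSum _ fun i _ =>
    Integrable.mul_isSmooth (hu.1.eval_piLp i) (hψ.partialDeriv i)]
  simpa only [inner_eq_sum, gradient_apply] using hu.2 ψ hψ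

lemma IsWeakCurl.integral_apply (hu : IsWeakCurl u w) {ψ : T3 → ℝ} (hψ : IsSmooth ψ) (k : Fin 3) :
    ∫ x, w x k * ψ x = (∫ x, u x (k + 1) * partialDeriv (k + 2) ψ x)
      - ∫ x, u x (k + 2) * partialDeriv (k + 1) ψ x := by
  have h := hu.2.2 (fun x => EuclideanSpace.single k (ψ x)) (isSmooth_iff.2 fun i => by
    by_cases hik : i = k
    · simpa [hik] using hψ
    · simpa [hik] using isSmooth_const (0 : ℝ))
  have hI : ∀ i j, Integrable (fun x => u x i * partialDeriv j ψ x) volume := fun i j =>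
    Integrable.mul_isSmooth (hu.1.eval_piLp i) (hψ.partialDeriv j)
  rw [← integral_sub (hI _ _) (hI _ _)]
  simp only [inner_eq_sum, Fin.sum_univ_three, curl_apply] at h
  fin_cases k <;> simpa [sub_eq_add_neg, add_comm] using h

/-- Pairing a mollified function with a test function averages the pairings with its translates,
which are again test functions. A weak identity valid for each translate thus passes to the
mollification. -/
lemma IsKernel.integral_conv_mul (hK : IsKernel K) {f ψ : T3 → ℝ} (hf : Integrable f volume)
    (hψ : IsSmooth ψ) :
    ∫ x, conv K f x * ψ x = ∫ y, K y * ∫ x, f x * ψ (x - -toTorus y) := by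
  simp_rw [mul_comm (conv K f _)]
  rw [integral_mul_conv_eq hK.continuous hK.compact (hψ.memLp ⊤) (memLp_one_iff_integrable.2 hf)]
  refine integral_congr_ae (ae_of_all _ fun y => ?_)
  simp only [integral_mul_shift ψ f]
  congr 2; funext x; ring

lemma IsKernel.integrable_kernel_mul (hK : IsKernel K) {f ψ : T3 → ℝ} (hf : Integrable f volume)
    (hψ : IsSmooth ψ) :
    Integrable (fun y => K y * ∫ x, f x * ψ (x - -toTorus y)) volume := by
  have h := (integrable_prod_shear hK.continuous hK.compact (hψ.memLp ⊤)
    (memLp_one_iff_integrable.2 hf)).integral_prod_right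
  refine h.congr (ae_of_all _ fun y => ?_)
  simp only [integral_const_mul, integral_mul_shift ψ f]
  congr 2; funext x; ring

/-- Mollification of a weakly divergence-free field is classically divergence-free. -/
lemma IsKernel.divergence_vconv (hK : IsKernel K) (hu : IsWeaklyDivFree u) (x : T3) :
    divergence (vconv K u) x = 0 := by
  have hs : ∀ i, IsSmooth (conv K fun z => u z i) := fun i => hK.isSmooth_conv (hu.1.eval_piLp i)
  refine congrFun (eq_zero_of_forall_integral_mul_eq_zero (g := divergence (vconv K u)) ?_ ?_) x
  · exact IsSmooth.sum fun i _ => (hs i).partialDeriv i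
  intro ψ hψ
  simp only [divergence, vconv_apply, Finset.sum_mul]
  rw [integral_finsetSum _ fun i _ => (((hs i).partialDeriv i).mul hψ).integrable]
  have h1 : ∀ i, ∫ x, partialDeriv i (conv K fun z => u z i) x * ψ x
      = -∫ y, K y * ∫ x, u x i * partialDeriv i ψ (x - -toTorus y) := fun i => by
    rw [← hK.integral_conv_mul (hu.1.eval_piLp i) (hψ.partialDeriv i),
      integral_mul_partialDeriv i (hs i) hψ, neg_neg]
  simp_rw [h1, Finset.sum_neg_distrib]
  rw [← integral_finsetSum _ fun i _ =>
    hK.integrable_kernel_mul (hu.1.eval_piLp i) (hψ.partialDeriv i), neg_eq_zero]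
  refine integral_eq_zero_of_ae (ae_of_all _ fun y => ?_)
  have := hu.sum_integral (hψ.comp_sub (-toTorus y))
  simp only [partialDeriv_comp_sub] at this
  simp only [← Finset.mul_sum, this, mul_zero, Pi.zero_apply]

/-- Mollification commutes with the curl. -/
lemma IsKernel.curl_vconv (hK : IsKernel K) (hu : IsWeakCurl u w) :
    curl (vconv K u) = vconv K w := by
  have hs : ∀ i, IsSmooth (conv K fun z => u z i) := fun i => hK.isSmooth_conv (hu.1.eval_piLp i)
  have hw : ∀ i, IsSmooth (conv K fun z => w z i) := fun i => hK.isSmooth_conv (hu.2.1.eval_piLp i)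
  funext x
  ext k
  rw [curl_apply, ← sub_eq_zero]
  refine congrFun (eq_zero_of_forall_integral_mul_eq_zero
    (g := fun x => partialDeriv (k + 1) (fun z => vconv K u z (k + 2)) x
      - partialDeriv (k + 2) (fun z => vconv K u z (k + 1)) x - vconv K w x k)
    ((((hs _).partialDeriv _).sub ((hs _).partialDeriv _)).sub (hw k)) fun ψ hψ => ?_) x
  simp only [vconv_apply, sub_mul]
  have i1 : ∀ i j, Integrable (fun x => partialDeriv i (conv K fun z => u z j) x * ψ x) volume :=
    fun i j => (((hs j).partialDeriv i).mul hψ).integrable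
  refine (integral_sub (((i1 (k + 1) (k + 2)).sub (i1 (k + 2) (k + 1))))
    ((hw k).mul hψ).integrable).trans ?_
  rw [integral_sub' (i1 _ _) (i1 _ _)]
  have h1 : ∀ i j, ∫ x, partialDeriv i (conv K fun z => u z j) x * ψ x
      = -∫ y, K y * ∫ x, u x j * partialDeriv i ψ (x - -toTorus y) := fun i j => by
    rw [← hK.integral_conv_mul (hu.1.eval_piLp j) (hψ.partialDeriv i),
      integral_mul_partialDeriv i (hs j) hψ, neg_neg]
  have i2 : ∀ i j, Integrable (fun y => K y * ∫ x, u x j * partialDeriv i ψ (x - -toTorus y))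
      volume := fun i j => hK.integrable_kernel_mul (hu.1.eval_piLp j) (hψ.partialDeriv i)
  rw [h1, h1, hK.integral_conv_mul (hu.2.1.eval_piLp k) hψ, neg_sub_neg,
    ← integral_sub (i2 _ _) (i2 _ _), sub_eq_zero]
  refine integral_congr_ae (ae_of_all _ fun y => ?_)
  have := hu.integral_apply (hψ.comp_sub (-toTorus y)) k
  simp only [partialDeriv_comp_sub] at this
  simp only [this, mul_sub]

end WeakDiff

/-! ### Fourier series and the inverse curl. -/

section Fourier

open ComplexConjugate

/-- The `L²` normalized Fourier monomials, for the measure `volume` on `T3`. -/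
def monomialLp (n : Fin 3 → ℤ) : Lp ℂ 2 (volume : Measure T3) :=
  ContinuousMap.toLp (E := ℂ) 2 volume ℂ (UnitAddTorus.mFourier n)

lemma coeFn_monomialLp (n : Fin 3 → ℤ) : monomialLp n =ᵐ[volume] UnitAddTorus.mFourier n :=
  ContinuousMap.coeFn_toLp volume (UnitAddTorus.mFourier n)

/-- For period 1 the two normalisations agree, so the orthonormality of the monomials transfers to
`volume`. -/
lemma volume_eq_pi_haar :
    (volume : Measure T3) = Measure.pi fun _ => AddCircle.haarAddCircle := by
  change Measure.pi (fun _ => (volume : Measure UnitAddCircle)) = _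
  congr 1
  funext i
  rw [AddCircle.volume_eq_smul_haarAddCircle, ENNReal.ofReal_one, one_smul]

lemma orthonormal_monomialLp : Orthonormal ℂ monomialLp := by
  rw [orthonormal_iff_ite]
  intro m n
  have h := orthonormal_iff_ite.1 (UnitAddTorus.orthonormal_mFourier (d := Fin 3)) m n
  rw [ContinuousMap.inner_toLp] at h
  rw [monomialLp, monomialLp, ContinuousMap.inner_toLp, volume_eq_pi_haar]
  exact h

/-- The Hilbert basis of Fourier monomials. -/
def monomialBasis : HilbertBasis (Fin 3 → ℤ) ℂ (Lp ℂ 2 (volume : Measure T3)) :=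
  HilbertBasis.mk orthonormal_monomialLp (by
    refine ge_of_eq ?_
    have := (ContinuousMap.toLp_denseRange (p := 2) ℂ (volume : Measure T3) ℂ
      (by simp)).topologicalClosure_map_submodule UnitAddTorus.span_mFourier_closure_eq_top
    simp only [Submodule.map_span, ContinuousLinearMap.coe_coe, ← range_comp,
      Function.comp_def] at this
    exact this)

/-- The Fourier coefficients of a function on the torus. -/
def coeff (F : T3 → ℂ) (n : Fin 3 → ℤ) : ℂ := ∫ x, conj (UnitAddTorus.mFourier n x) * F x

lemma monomialBasis_repr (F : Lp ℂ 2 (volume : Measure T3)) (n : Fin 3 → ℤ) :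
    monomialBasis.repr F n = coeff F n := by
  rw [monomialBasis.repr_apply_apply, MeasureTheory.L2.inner_def, monomialBasis,
    HilbertBasis.coe_mk]
  refine integral_congr_ae ?_
  filter_upwards [coeFn_monomialLp n] with x hx
  rw [hx]
  simp [mul_comm]

lemma coeff_congr {F G : T3 → ℂ} (h : F =ᵐ[volume] G) (n : Fin 3 → ℤ) : coeff F n = coeff G n :=
  integral_congr_ae (by filter_upwards [h] with x hx; rw [hx])

lemma memℓp_coeff {F : T3 → ℂ} (hF : MemLp F 2 volume) : Memℓp (coeff F) 2 := by
  have e : coeff F = monomialBasis.repr hF.toLp := by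
    funext n
    rw [monomialBasis_repr, coeff_congr hF.coeFn_toLp]
  rw [e]
  exact (monomialBasis.repr hF.toLp).2

lemma exists_coeff_eq {a : (Fin 3 → ℤ) → ℂ} (ha : Memℓp a 2) :
    ∃ F : T3 → ℂ, MemLp F 2 volume ∧ ∀ n, coeff F n = a n := by
  refine ⟨monomialBasis.repr.symm ⟨a, ha⟩, Lp.memLp _, fun n => ?_⟩
  rw [← monomialBasis_repr, LinearIsometryEquiv.apply_symm_apply]

/-- Parseval's identity. -/
lemma hasSum_coeff_mul {F G : T3 → ℂ} (hF : MemLp F 2 volume) (hG : MemLp G 2 volume) :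
    HasSum (fun n => conj (coeff G n) * coeff F n) (∫ x, conj (G x) * F x) := by
  have h := monomialBasis.hasSum_inner_mul_inner hG.toLp hF.toLp
  have e : inner ℂ hG.toLp hF.toLp = ∫ x, conj (G x) * F x := by
    rw [MeasureTheory.L2.inner_def]
    refine integral_congr_ae ?_
    filter_upwards [hF.coeFn_toLp, hG.coeFn_toLp] with x h1 h2
    rw [h1, h2]; simp [mul_comm]
  rw [e] at h
  refine h.congr_fun fun n => ?_
  rw [← inner_conj_symm hG.toLp, ← monomialBasis.repr_apply_apply, ← monomialBasis.repr_apply_apply,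
    monomialBasis_repr, monomialBasis_repr, coeff_congr hF.coeFn_toLp, coeff_congr hG.coeFn_toLp]

lemma mFourier_toTorus (n : Fin 3 → ℤ) (y : E3) :
    UnitAddTorus.mFourier n (toTorus y)
      = Complex.exp ((2 * Real.pi * ∑ j, (n j : ℝ) * y j : ℝ) * Complex.I) := by
  simp only [UnitAddTorus.mFourier, ContinuousMap.coe_mk, toTorus, fourier_coe_apply,
    ← Complex.exp_sum]
  congr 1
  push_cast
  rw [Finset.mul_sum, Finset.sum_mul]
  refine Finset.sum_congr rfl fun j _ => ?_
  simp only [div_one]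
  ring

/-- The real part of a Fourier monomial. -/
def cosMode (n : Fin 3 → ℤ) (x : T3) : ℝ := (UnitAddTorus.mFourier n x).re

/-- The imaginary part of a Fourier monomial. -/
def sinMode (n : Fin 3 → ℤ) (x : T3) : ℝ := (UnitAddTorus.mFourier n x).im

lemma cosMode_toTorus (n : Fin 3 → ℤ) (y : E3) :
    cosMode n (toTorus y) = Real.cos (2 * Real.pi * ∑ j, (n j : ℝ) * y j) := by
  rw [cosMode, mFourier_toTorus, Complex.exp_ofReal_mul_I_re]

lemma sinMode_toTorus (n : Fin 3 → ℤ) (y : E3) :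
    sinMode n (toTorus y) = Real.sin (2 * Real.pi * ∑ j, (n j : ℝ) * y j) := by
  rw [sinMode, mFourier_toTorus, Complex.exp_ofReal_mul_I_im]

lemma isSmooth_cosMode (n : Fin 3 → ℤ) : IsSmooth (cosMode n) := by
  simp only [IsSmooth, cosMode_toTorus]
  fun_prop

lemma isSmooth_sinMode (n : Fin 3 → ℤ) : IsSmooth (sinMode n) := by
  simp only [IsSmooth, sinMode_toTorus]
  fun_prop

lemma hasDerivAt_phase (n : Fin 3 → ℤ) (i : Fin 3) (y : E3) :
    HasDerivAt (fun s : ℝ => 2 * Real.pi * ∑ j, (n j : ℝ) * (y + EuclideanSpace.single i s) j)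
      (2 * Real.pi * n i) 0 := by
  have h : ∀ s : ℝ, 2 * Real.pi * ∑ j, (n j : ℝ) * (y + EuclideanSpace.single i s) j
      = 2 * Real.pi * ∑ j, (n j : ℝ) * y j + s * (2 * Real.pi * n i) := fun s => by
    simp only [PiLp.add_apply, mul_add, Finset.sum_add_distrib]
    have : ∑ j, (n j : ℝ) * (EuclideanSpace.single i s : E3) j = n i * s := by
      rw [Finset.sum_eq_single i] <;> simp +contextual
    rw [this]; ring
  simp_rw [h]
  have h2 := ((hasDerivAt_id (0 : ℝ)).mul_const (2 * Real.pi * n i)).const_add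
    (2 * Real.pi * ∑ j, (n j : ℝ) * y j)
  rwa [one_mul] at h2

lemma partialDeriv_cosMode (n : Fin 3 → ℤ) (i : Fin 3) (x : T3) :
    partialDeriv i (cosMode n) x = -(2 * Real.pi * n i) * sinMode n x := by
  obtain ⟨y, rfl⟩ := toTorus_surjective x
  simp only [partialDeriv, ← toTorus_add, cosMode_toTorus, sinMode_toTorus]
  rw [(hasDerivAt_phase n i y).cos.deriv]
  simp; ring

lemma partialDeriv_sinMode (n : Fin 3 → ℤ) (i : Fin 3) (x : T3) :
    partialDeriv i (sinMode n) x = (2 * Real.pi * n i) * cosMode n x := by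
  obtain ⟨y, rfl⟩ := toTorus_surjective x
  simp only [partialDeriv, ← toTorus_add, cosMode_toTorus, sinMode_toTorus]
  rw [(hasDerivAt_phase n i y).sin.deriv]
  simp; ring

lemma coeff_ofReal {f : T3 → ℝ} (hf : Integrable f volume) (n : Fin 3 → ℤ) :
    coeff (fun x => (f x : ℂ)) n
      = ((∫ x, cosMode n x * f x : ℝ) : ℂ) - Complex.I * ((∫ x, sinMode n x * f x : ℝ) : ℂ) := by
  have h1 : Integrable (fun x => ((cosMode n x * f x : ℝ) : ℂ)) volume :=
    (Integrable.isSmooth_mul hf (isSmooth_cosMode n)).ofReal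
  have h2 : Integrable (fun x => ((sinMode n x * f x : ℝ) : ℂ)) volume :=
    (Integrable.isSmooth_mul hf (isSmooth_sinMode n)).ofReal
  rw [← integral_complex_ofReal, ← integral_complex_ofReal, ← integral_const_mul,
    ← integral_sub h1 (h2.const_mul _), coeff]
  refine integral_congr_ae (ae_of_all _ fun x => ?_)
  apply Complex.ext <;> simp [cosMode, sinMode]

lemma coeff_partialDeriv {f : T3 → ℝ} (hf : IsSmooth f) (i : Fin 3) (n : Fin 3 → ℤ) :
    coeff (fun x => (partialDeriv i f x : ℂ)) n
      = 2 * Real.pi * Complex.I * n i * coeff (fun x => (f x : ℂ)) n := by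
  rw [coeff_ofReal (hf.partialDeriv i).integrable, coeff_ofReal hf.integrable,
    integral_mul_partialDeriv i (isSmooth_cosMode n) hf,
    integral_mul_partialDeriv i (isSmooth_sinMode n) hf]
  simp_rw [partialDeriv_cosMode, partialDeriv_sinMode, mul_assoc, integral_const_mul]
  push_cast
  ring_nf
  simp only [Complex.I_sq]
  ring

/-- The condition n · û(n) = 0, from testing with the real and imaginary parts of the monomial,
since test functions are real. -/
lemma IsWeaklyDivFree.sum_coeff {u : T3 → E3} (hu : IsWeaklyDivFree u) (n : Fin 3 → ℤ) :
    ∑ i, (n i : ℂ) * coeff (fun x => (u x i : ℂ)) n = 0 := by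
  have hc := hu.sum_integral (isSmooth_cosMode n)
  have hs := hu.sum_integral (isSmooth_sinMode n)
  have e1 : ∀ i, ∫ x, u x i * partialDeriv i (cosMode n) x
      = -(2 * Real.pi) * (n i * ∫ x, sinMode n x * u x i) := fun i => by
    simp_rw [partialDeriv_cosMode]
    rw [← integral_const_mul, ← integral_const_mul]
    congr 1; funext x; ring
  have e2 : ∀ i, ∫ x, u x i * partialDeriv i (sinMode n) x
      = (2 * Real.pi) * (n i * ∫ x, cosMode n x * u x i) := fun i => by
    simp_rw [partialDeriv_sinMode]
    rw [← integral_const_mul, ← integral_const_mul]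
    congr 1; funext x; ring
  simp_rw [e1, ← Finset.mul_sum] at hc
  simp_rw [e2, ← Finset.mul_sum] at hs
  have hp := Real.pi_pos.ne'
  have hc' : ∑ i, (n i : ℝ) * ∫ x, sinMode n x * u x i = 0 := by simpa [hp] using hc
  have hs' : ∑ i, (n i : ℝ) * ∫ x, cosMode n x * u x i = 0 := by simpa [hp] using hs
  simp_rw [coeff_ofReal (hu.1.eval_piLp _), mul_sub, Finset.sum_sub_distrib, mul_left_comm _ Complex.I,
    ← Finset.mul_sum]
  have hc2 := congrArg (fun r : ℝ => (r : ℂ)) hc'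
  have hs2 := congrArg (fun r : ℝ => (r : ℂ)) hs'
  push_cast at hc2 hs2 ⊢
  rw [hc2, hs2]; simp

/-- The Fourier multiplier of the inverse curl applied to the coefficients `c`. -/
def curlInvCoeff (c : Fin 3 → (Fin 3 → ℤ) → ℂ) (k : Fin 3) (n : Fin 3 → ℤ) : ℂ :=
  Complex.I / (2 * Real.pi * ∑ i, (n i : ℂ) ^ 2)
    * (n (k + 1) * c (k + 2) n - n (k + 2) * c (k + 1) n)

lemma sum_sq_ne_zero {n : Fin 3 → ℤ} (hn : n ≠ 0) : ∑ i, (n i : ℂ) ^ 2 ≠ 0 := by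
  have h : ∑ i, (n i) ^ 2 ≠ 0 := by
    intro h
    rw [Finset.sum_eq_zero_iff_of_nonneg fun i _ => sq_nonneg _] at h
    exact hn (funext fun i => by simpa using h i (Finset.mem_univ i))
  exact_mod_cast h

/-- Integrality gives |n_k| ≤ n_k² ≤ |n|², and 2π ≥ 1. At n = 0 the division by zero returns 0. This
boundedness keeps the multiplier on ℓ². -/
lemma norm_div_sum_sq_le (n : Fin 3 → ℤ) (k : Fin 3) :
    ‖Complex.I / (2 * Real.pi * ∑ i, (n i : ℂ) ^ 2) * n k‖ ≤ 1 := by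
  have e : ‖∑ i, (n i : ℂ) ^ 2‖ = ∑ i, (n i : ℝ) ^ 2 := by
    have : ∑ i, (n i : ℂ) ^ 2 = ((∑ i, (n i : ℝ) ^ 2 : ℝ) : ℂ) := by push_cast; rfl
    rw [this, Complex.norm_real, Real.norm_of_nonneg (Finset.sum_nonneg fun i _ => sq_nonneg _)]
  have e2 : ‖(n k : ℂ)‖ = |(n k : ℝ)| := Complex.norm_intCast _
  rw [norm_mul, norm_div, Complex.norm_I, norm_mul, norm_mul, e, e2, Complex.norm_real,
    Real.norm_of_nonneg Real.pi_pos.le, Complex.norm_ofNat]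
  have h1 : (n k : ℝ) ^ 2 ≤ ∑ i, (n i : ℝ) ^ 2 :=
    Finset.single_le_sum (f := fun i => (n i : ℝ) ^ 2) (fun i _ => sq_nonneg _) (Finset.mem_univ k)
  have h2 : |(n k : ℝ)| ≤ (n k : ℝ) ^ 2 := by
    have : |n k| ≤ (n k) ^ 2 := by
      rw [← sq_abs]; exact Int.le_self_sq _
    exact_mod_cast this
  have h3 : (1 : ℝ) ≤ 2 * Real.pi := by linarith [Real.pi_gt_three]
  have hS : 0 ≤ ∑ i, (n i : ℝ) ^ 2 := Finset.sum_nonneg fun i _ => sq_nonneg _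
  rw [div_mul_eq_mul_div, one_mul]
  refine div_le_one_of_le₀ ?_ (by positivity)
  nlinarith

lemma memℓp_curlInvCoeff {c : Fin 3 → (Fin 3 → ℤ) → ℂ} (hc : ∀ k, Memℓp (c k) 2) (k : Fin 3) :
    Memℓp (curlInvCoeff c k) 2 := by
  have h : ∀ i j, Memℓp (fun n : Fin 3 → ℤ =>
      Complex.I / (2 * Real.pi * ∑ i, (n i : ℂ) ^ 2) * n i * c j n) 2 := fun i j => by
    refine (hc j).mono' fun n => ?_
    rw [norm_mul]
    exact mul_le_of_le_one_left (norm_nonneg _) (norm_div_sum_sq_le n i)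
  convert (h (k + 1) (k + 2)).sub (h (k + 2) (k + 1)) using 1
  funext n
  simp only [curlInvCoeff, Pi.sub_apply]
  ring

/-- The Fourier symbol form of `curl (curl⁻¹ c) = c` for divergence-free `c` of zero mean. -/
lemma sum_curlInvCoeff_mul {c : Fin 3 → (Fin 3 → ℤ) → ℂ} {n : Fin 3 → ℤ}
    (h0 : n = 0 → ∀ k, c k n = 0) (hdiv : ∑ i, (n i : ℂ) * c i n = 0) (a : Fin 3 → ℂ) :
    ∑ k, conj (2 * Real.pi * Complex.I * n (k + 1) * a (k + 2)
        - 2 * Real.pi * Complex.I * n (k + 2) * a (k + 1)) * curlInvCoeff c k n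
      = ∑ k, conj (a k) * c k n := by
  by_cases hn : n = 0
  · simp [h0 hn, curlInvCoeff]
  have hS := sum_sq_ne_zero hn
  have hpi : (Real.pi : ℂ) ≠ 0 := by exact_mod_cast Real.pi_pos.ne'
  simp only [curlInvCoeff, Fin.sum_univ_three, Fin.isValue, map_sub, map_mul, map_intCast,
    Complex.conj_I, Complex.conj_ofReal, map_ofNat] at hS hdiv ⊢
  simp only [show (0 : Fin 3) + 1 = 1 from rfl, show (0 : Fin 3) + 2 = 2 from rfl,
    show (1 : Fin 3) + 1 = 2 from rfl, show (1 : Fin 3) + 2 = 0 from rfl,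
    show (2 : Fin 3) + 1 = 0 from rfl, show (2 : Fin 3) + 2 = 1 from rfl]
  field_simp
  ring_nf
  simp only [Complex.I_sq]
  -- This is n × (n × c) = (n · c) n - |n|² c paired with a; the first term vanishes because n · c =
  -- 0.
  linear_combination (conj (a 0) * n 0 + conj (a 1) * n 1 + conj (a 2) * n 2) * (-hdiv)

/-- The triple product n · (n × c) vanishes, whence the potential is divergence-free. -/
lemma sum_mul_curlInvCoeff (c : Fin 3 → (Fin 3 → ℤ) → ℂ) (n : Fin 3 → ℤ) :
    ∑ k, (n k : ℂ) * curlInvCoeff c k n = 0 := by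
  simp only [curlInvCoeff, Fin.sum_univ_three, Fin.isValue,
    show (0 : Fin 3) + 1 = 1 from rfl, show (0 : Fin 3) + 2 = 2 from rfl,
    show (1 : Fin 3) + 1 = 2 from rfl, show (1 : Fin 3) + 2 = 0 from rfl,
    show (2 : Fin 3) + 1 = 0 from rfl, show (2 : Fin 3) + 2 = 1 from rfl]
  ring

lemma coeff_zero (F : T3 → ℂ) : coeff F 0 = ∫ x, F x := by
  simp [coeff, UnitAddTorus.mFourier_zero]

lemma IsSmooth.memLp_ofReal {f : T3 → ℝ} (hf : IsSmooth f) :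
    MemLp (fun x => (f x : ℂ)) 2 volume := (hf.memLp 2).ofReal

lemma integral_re_mul {F : T3 → ℂ} (hF : MemLp F 2 volume) {f : T3 → ℝ} (hf : IsSmooth f) :
    ∫ x, (F x).re * f x = (∫ x, conj (f x : ℂ) * F x).re := by
  have h : Integrable (fun x => conj (f x : ℂ) * F x) volume := by
    obtain ⟨C, hC⟩ := hf.exists_bound
    refine (hF.integrable (by norm_num)).bdd_mul (c := C) ?_ (ae_of_all _ fun x => by
      simpa using hC x)
    exact (by have := hf.continuous; fun_prop : Continuous fun x => conj (f x : ℂ)).aestronglyMeasurable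
  rw [← RCLike.re_eq_complex_re, ← integral_re h]
  refine integral_congr_ae (ae_of_all _ fun x => ?_)
  simp [mul_comm]

/-- Existence of the inverse curl of a square integrable divergence-free field of zero mean. -/
theorem exists_isCurlInv {h : T3 → E3} (hL : MemLp h 2 volume) (hdiv : IsWeaklyDivFree h)
    (hmean : ∫ x, h x = 0) : ∃ H : T3 → E3, IsCurlInv H h := by
  set c : Fin 3 → (Fin 3 → ℤ) → ℂ := fun k => coeff fun x => (h x k : ℂ) with hc
  have hLk : ∀ k, MemLp (fun x => (h x k : ℂ)) 2 volume := fun k => (hL.eval_piLp k).ofReal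
  choose F hF hFc using fun k => exists_coeff_eq (memℓp_curlInvCoeff (fun k => memℓp_coeff (hLk k)) k)
  have hHL : MemLp (fun x => (WithLp.toLp 2 fun k => (F k x).re : E3)) 2 volume :=
    MemLp.of_eval_piLp fun k => (hF k).re
  have hHI := hHL.integrable (by norm_num)
  have hI := hL.integrable (by norm_num)
  have h0 : ∀ n, n = 0 → ∀ k, c k n = 0 := by
    rintro _ rfl k
    rw [hc]
    simp only [coeff_zero]
    rw [integral_complex_ofReal, ← eval_integral_piLp fun i => hI.eval_piLp i, hmean]
    simp
  refine ⟨fun x => WithLp.toLp 2 fun k => (F k x).re, hHL, ⟨hHI, fun ψ hψ => ?_⟩,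
    ⟨hHI, hI, fun φ hφ => ?_⟩, ?_⟩
  · simp only [inner_eq_sum, gradient_apply]
    rw [integral_finsetSum _ fun i _ =>
      Integrable.mul_isSmooth (hHI.eval_piLp i) (hψ.partialDeriv i)]
    simp_rw [integral_re_mul (hF _) (hψ.partialDeriv _)]
    rw [← Complex.re_sum]
    have hs := hasSum_sum fun i (_ : i ∈ Finset.univ) =>
      hasSum_coeff_mul (hF i) (hψ.partialDeriv i).memLp_ofReal
    rw [← hs.tsum_eq, tsum_congr (g := fun _ => 0), tsum_zero, Complex.zero_re]
    intro n
    simp_rw [coeff_partialDeriv hψ, hFc]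
    have := sum_mul_curlInvCoeff c n
    simp only [map_mul, map_intCast]
    calc _ = conj (2 * Real.pi * Complex.I) * conj (coeff (fun x => (ψ x : ℂ)) n)
        * ∑ k, (n k : ℂ) * curlInvCoeff c k n := by
          rw [Finset.mul_sum]
          refine Finset.sum_congr rfl fun i _ => ?_
          simp only [map_mul]; ring
      _ = 0 := by rw [this, mul_zero]
  · have hφi := isSmooth_iff.1 hφ
    have hci := isSmooth_iff.1 hφ.curl
    simp only [inner_eq_sum]
    rw [integral_finsetSum _ fun i _ => Integrable.mul_isSmooth (hI.eval_piLp i) (hφi i),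
      integral_finsetSum _ fun i _ => Integrable.mul_isSmooth (hHI.eval_piLp i) (hci i)]
    have e : ∀ i, ∫ x, h x i * φ x i = (∫ x, conj (φ x i : ℂ) * (h x i : ℂ)).re := fun i =>
      integral_re_mul (hLk i) (hφi i)
    simp_rw [e, integral_re_mul (hF _) (hci _)]
    rw [← Complex.re_sum, ← Complex.re_sum]
    congr 1
    have hs1 := hasSum_sum fun i (_ : i ∈ Finset.univ) =>
      hasSum_coeff_mul (hLk i) (hφi i).memLp_ofReal
    have hs2 := hasSum_sum fun i (_ : i ∈ Finset.univ) =>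
      hasSum_coeff_mul (hF i) (hci i).memLp_ofReal
    -- By Parseval both pairings are sums of series, and these agree term by term.
    refine hs1.unique (hs2.congr_fun fun n => ?_)
    have hcurl : ∀ k, coeff (fun x => (curl φ x k : ℂ)) n
        = 2 * Real.pi * Complex.I * n (k + 1) * coeff (fun x => (φ x (k + 2) : ℂ)) n
          - 2 * Real.pi * Complex.I * n (k + 2) * coeff (fun x => (φ x (k + 1) : ℂ)) n := fun k => by
      rw [← coeff_partialDeriv (hφi _), ← coeff_partialDeriv (hφi _)]
      rw [coeff_ofReal (hci k).integrable, coeff_ofReal ((hφi _).partialDeriv _).integrable,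
        coeff_ofReal ((hφi _).partialDeriv _).integrable]
      simp_rw [curl_apply, mul_sub]
      rw [integral_sub ((isSmooth_cosMode n).mul ((hφi _).partialDeriv _)).integrable
        ((isSmooth_cosMode n).mul ((hφi _).partialDeriv _)).integrable,
        integral_sub ((isSmooth_sinMode n).mul ((hφi _).partialDeriv _)).integrable
        ((isSmooth_sinMode n).mul ((hφi _).partialDeriv _)).integrable]
      push_cast
      ring
    have := sum_curlInvCoeff_mul (h0 n) (hdiv.sum_coeff n)
      (fun k => coeff (fun x => (φ x k : ℂ)) n)
    simp_rw [hcurl, hFc]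
    exact this.symm
  · ext k
    rw [eval_integral_piLp fun i => hHI.eval_piLp i]
    have : ∫ x, (F k x).re = (∫ x, F k x).re := by
      simpa using integral_re_mul (hF k) (isSmooth_const (1 : ℝ))
    simp only [this, ← coeff_zero, hFc]
    -- The multiplier is zero at n = 0, so the zero mean is automatic.
    simp [curlInvCoeff]

end Fourier

/-! ### The flux as a cubic form in increments. -/

section Trilinear

instance : ENNReal.HolderTriple 3 3 (3 / 2) := ⟨by
  rw [ENNReal.inv_div (by simp) (by simp), ← one_div, ENNReal.div_add_div_same]
  norm_num⟩

instance : ENNReal.HolderTriple (3 / 2) 3 1 := ⟨by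
  rw [ENNReal.inv_div (by simp) (by simp), ← one_div, ENNReal.div_add_div_same, inv_one]
  rw [show (2 + 1 : ENNReal) = 3 by norm_num, ENNReal.div_self (by simp) (by simp)]⟩

variable {K : E3 → ℝ} {u : T3 → E3}

/-- The flux `∫ u ⊗ u : ∇ (K * v)`. -/
def flux (K : E3 → ℝ) (u v : T3 → E3) : ℝ :=
  ∑ i, ∑ k, ∫ x, u x i * u x k * conv (kernelDeriv i K) (fun z => v z k) x

lemma kernelDeriv_neg (he : ∀ y, K (-y) = K y) (i : Fin 3) (y : E3) :
    kernelDeriv i K (-y) = -kernelDeriv i K y := by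
  have h : fderiv ℝ K y = -fderiv ℝ K (-y) := by
    conv_lhs => rw [show K = fun y => K (-y) from funext fun y => (he y).symm]
    have hd := fderiv_comp_smul (f := K) (x := y) (-1 : ℝ)
    simpa only [neg_smul, one_smul] using hd
  simp [kernelDeriv, h]

lemma sum_kernelDeriv_mul (K : E3 → ℝ) (y v : E3) :
    ∑ i, kernelDeriv i K y * v i = fderiv ℝ K y v := by
  conv_rhs => rw [← (EuclideanSpace.basisFun (Fin 3) ℝ).sum_repr v]
  simp [kernelDeriv, map_sum, mul_comm]

/-- A derivative of a compactly supported kernel has zero integral, seen here by differentiating the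
constant K∗1. -/
lemma IsKernel.conv_kernelDeriv_one (hK : IsKernel K) (i : Fin 3) (x : T3) :
    conv (EMHD.kernelDeriv i K) (fun _ => 1) x = 0 := by
  rw [← hK.partialDeriv_conv (integrable_const 1)]
  have : conv K (fun _ => 1) = fun _ => ∫ y, K y := by funext x; simp [conv]
  rw [this, partialDeriv_const]

lemma integral_comp_reflection {Φ : T3 × E3 → ℝ} (hΦ : Integrable Φ (volume.prod volume)) :
    ∫ z : T3 × E3, Φ (z.1 - toTorus z.2, -z.2) ∂(volume.prod volume)
      = ∫ z, Φ z ∂(volume.prod volume) := by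
  have hR := measurePreserving_reflection
  conv_rhs => rw [← hR.map_eq]
  rw [integral_map hR.measurable.aemeasurable (by rw [hR.map_eq]; exact hΦ.aestronglyMeasurable)]

lemma integrable_comp_reflection {Φ : T3 × E3 → ℝ} (hΦ : Integrable Φ (volume.prod volume)) :
    Integrable (fun z : T3 × E3 => Φ (z.1 - toTorus z.2, -z.2)) (volume.prod volume) :=
  measurePreserving_reflection.integrable_comp_of_integrable hΦ

/-- The flux as a cubic form in the increments of `u`. -/
lemma IsKernel.integral_increment (hK : IsKernel K) (he : ∀ y, K (-y) = K y)
    (hu : MemLp u 3 volume) (hdiv : IsWeaklyDivFree u) :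
    Integrable (fun z : T3 × E3 => fderiv ℝ K z.2 (u z.1 - u (z.1 - toTorus z.2))
        * ‖u z.1 - u (z.1 - toTorus z.2)‖ ^ 2) (volume.prod volume) ∧
    ∫ z : T3 × E3, fderiv ℝ K z.2 (u z.1 - u (z.1 - toTorus z.2))
        * ‖u z.1 - u (z.1 - toTorus z.2)‖ ^ 2 ∂(volume.prod volume) = -4 * flux K u u := by
  have hui : ∀ i, MemLp (fun x => u x i) 3 volume := fun i => hu.eval_piLp i
  have huu : ∀ i k, MemLp (fun x => u x i * u x k) (3 / 2) volume := fun i k =>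
    (hui k).mul (hui i)
  have huuu : ∀ i k, MemLp (fun x => u x i * u x k * u x k) 1 volume := fun i k =>
    (hui k).mul (huu i k)
  set D := fun i => EMHD.kernelDeriv i K
  have hD : ∀ i, IsKernel (D i) := fun i => hK.kernelDeriv i
  have hDn : ∀ i y, D i (-y) = -D i y := fun i y => kernelDeriv_neg he i y
  have hone : MemLp (fun _ : T3 => (1 : ℝ)) ⊤ volume := memLp_const 1
  -- Expanding δu_i (δu_k)² gives six monomials: `P1`, `P2`, `P3` and their images under (x,y) ↦ (x
  -- - y, -y). The reflection swaps u(x) with u(x - y), and the oddness of ∂ᵢK supplies the signs.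
  -- It preserves the measure, so each pair contributes twice the integral of its first member.
  set P1 : Fin 3 → Fin 3 → T3 × E3 → ℝ := fun i k z =>
    D i z.2 * ((u z.1 i * u z.1 k * u z.1 k) * 1)
  set P2 : Fin 3 → Fin 3 → T3 × E3 → ℝ := fun i k z =>
    D i z.2 * ((u z.1 i * u z.1 k) * u (z.1 - toTorus z.2) k)
  set P3 : Fin 3 → Fin 3 → T3 × E3 → ℝ := fun i k z =>
    D i z.2 * ((u z.1 k * u z.1 k) * u (z.1 - toTorus z.2) i)
  have i1 : ∀ i k, Integrable (P1 i k) (volume.prod volume) := fun i k =>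
    integrable_prod_shear (hD i).continuous (hD i).compact (huuu i k) hone
  have i2 : ∀ i k, Integrable (P2 i k) (volume.prod volume) := fun i k =>
    integrable_prod_shear (hD i).continuous (hD i).compact (huu i k) (hui k)
  have i3 : ∀ i k, Integrable (P3 i k) (volume.prod volume) := fun i k =>
    integrable_prod_shear (hD i).continuous (hD i).compact (huu k k) (hui i)
  have e1 : ∀ i k, ∫ z, P1 i k z ∂(volume.prod volume) = 0 := fun i k => by
    have := integral_prod_shear (hD i).continuous (hD i).compact (huuu i k) hone
    simp only [D, hK.conv_kernelDeriv_one, mul_zero, integral_zero] at this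
    exact this
  have e2 : ∀ i k, ∫ z, P2 i k z ∂(volume.prod volume)
      = ∫ x, u x i * u x k * conv (D i) (fun z => u z k) x := fun i k =>
    integral_prod_shear (hD i).continuous (hD i).compact (huu i k) (hui k)
  -- Summed over `i`, the convolution factor is div (K∗u) = 0. This is where the divergence-free
  -- condition enters; only `P2`, the flux, survives.
  have e3 : ∀ k, ∑ i, ∫ z, P3 i k z ∂(volume.prod volume) = 0 := fun k => by
    have h3 : ∀ i, ∫ z, P3 i k z ∂(volume.prod volume)
        = ∫ x, u x k * u x k * conv (D i) (fun z => u z i) x := fun i =>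
      integral_prod_shear (hD i).continuous (hD i).compact (huu k k) (hui i)
    simp_rw [h3]
    rw [← integral_finsetSum _ fun i _ =>
      (hD i).integrable_mul_conv ((huu k k).integrable (by
        rw [ENNReal.le_div_iff_mul_le] <;> norm_num)) ((hui i).integrable (by norm_num))]
    refine integral_eq_zero_of_ae (ae_of_all _ fun x => ?_)
    have := hK.divergence_vconv hdiv x
    simp only [divergence, vconv_apply, hK.partialDeriv_conv (hdiv.1.eval_piLp _)] at this
    simp only [← Finset.mul_sum, D, this, mul_zero, Pi.zero_apply]
  have hpt : ∀ z : T3 × E3, fderiv ℝ K z.2 (u z.1 - u (z.1 - toTorus z.2))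
        * ‖u z.1 - u (z.1 - toTorus z.2)‖ ^ 2
      = ∑ k, ∑ i, (P1 i k z + P1 i k (z.1 - toTorus z.2, -z.2)
        - 2 * (P2 i k z + P2 i k (z.1 - toTorus z.2, -z.2))
        - (P3 i k z + P3 i k (z.1 - toTorus z.2, -z.2))) := by
    intro z
    rw [← sum_kernelDeriv_mul, EuclideanSpace.norm_sq_eq, mul_comm, Finset.sum_mul_sum]
    refine Finset.sum_congr rfl fun k _ => Finset.sum_congr rfl fun i _ => ?_
    simp only [P1, P2, P3, hDn, Real.norm_eq_abs, sq_abs, PiLp.sub_apply, toTorus_neg,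
      sub_neg_eq_add, sub_add_cancel]
    simp only [D]
    ring
  simp_rw [hpt]
  have i1' := fun i k => integrable_comp_reflection (i1 i k)
  have i2' := fun i k => integrable_comp_reflection (i2 i k)
  have i3' := fun i k => integrable_comp_reflection (i3 i k)
  have hint : ∀ i k, Integrable (fun z : T3 × E3 => P1 i k z + P1 i k (z.1 - toTorus z.2, -z.2)
        - 2 * (P2 i k z + P2 i k (z.1 - toTorus z.2, -z.2))
        - (P3 i k z + P3 i k (z.1 - toTorus z.2, -z.2))) (volume.prod volume) := fun i k => (((i1 i k).add (i1' i k)).sub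
    (((i2 i k).add (i2' i k)).const_mul 2)).sub ((i3 i k).add (i3' i k))
  have hik : ∀ k i, ∫ z : T3 × E3, (P1 i k z + P1 i k (z.1 - toTorus z.2, -z.2)
        - 2 * (P2 i k z + P2 i k (z.1 - toTorus z.2, -z.2))
        - (P3 i k z + P3 i k (z.1 - toTorus z.2, -z.2))) ∂(volume.prod volume)
      = -4 * (∫ x, u x i * u x k * conv (D i) (fun z => u z k) x)
        - 2 * ∫ z, P3 i k z ∂(volume.prod volume) := fun k i => by
    refine (integral_sub (((i1 i k).add (i1' i k)).sub
      (((i2 i k).add (i2' i k)).const_mul 2)) ((i3 i k).add (i3' i k))).trans ?_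
    rw [integral_sub' ((i1 i k).add (i1' i k)) (((i2 i k).add (i2' i k)).const_mul 2),
      integral_const_mul, integral_add' (i1 i k) (i1' i k), integral_add' (i2 i k) (i2' i k),
      integral_add' (i3 i k) (i3' i k), integral_comp_reflection (i1 i k),
      integral_comp_reflection (i2 i k), integral_comp_reflection (i3 i k), e1, e2]
    ring
  refine ⟨integrable_finsetSum _ fun k _ => integrable_finsetSum _ fun i _ => hint i k, ?_⟩
  rw [integral_finsetSum _ fun k _ => integrable_finsetSum _ fun i _ => hint i k]
  have : ∀ k, ∫ z : T3 × E3, ∑ i, (P1 i k z + P1 i k (z.1 - toTorus z.2, -z.2)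
        - 2 * (P2 i k z + P2 i k (z.1 - toTorus z.2, -z.2))
        - (P3 i k z + P3 i k (z.1 - toTorus z.2, -z.2))) ∂(volume.prod volume)
      = ∑ i, -4 * ∫ x, u x i * u x k * conv (D i) (fun z => u z k) x := fun k => by
    rw [integral_finsetSum _ fun i _ => hint i k]
    simp_rw [hik]
    rw [Finset.sum_sub_distrib, ← Finset.mul_sum (f := fun i => ∫ z, P3 i k z ∂_), e3]
    ring
  simp_rw [this, flux]
  rw [Finset.sum_comm]
  simp_rw [Finset.mul_sum]
  rfl

lemma IsKernel.enorm_flux_le (hK : IsKernel K) (he : ∀ y, K (-y) = K y)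
    (hu : MemLp u 3 volume) (hdiv : IsWeaklyDivFree u) :
    ‖flux K u u‖ₑ ≤ ∫⁻ x, ∫⁻ y, ‖fderiv ℝ K y‖ₑ * ‖u x - u (x - toTorus y)‖ₑ ^ 3 := by
  -- The factor 1/4 is discarded, since only the order of magnitude matters.
  have h4 : ‖flux K u u‖ₑ ≤ ‖-4 * flux K u u‖ₑ := by
    rw [enorm_mul]
    refine le_mul_of_one_le_left (by simp) ?_
    rw [← ofReal_norm]
    norm_num
  refine h4.trans ?_
  obtain ⟨hint, heq⟩ := hK.integral_increment he hu hdiv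
  rw [← heq, integral_prod _ hint]
  refine (enorm_integral_le_lintegral_enorm _).trans (lintegral_mono fun x => ?_)
  refine (enorm_integral_le_lintegral_enorm _).trans (lintegral_mono fun y => ?_)
  simp only
  rw [enorm_mul, enorm_pow, enorm_norm, pow_succ' _ 2, ← mul_assoc]
  gcongr
  exact ContinuousLinearMap.le_opENorm _ _

end Trilinear

/-! ### From a weak time derivative to an integral identity. -/

section DuBoisReymond

open Real (smoothTransition)

lemma contDiff_smoothTransition : ContDiff ℝ ((⊤ : ℕ∞) : WithTop ℕ∞) smoothTransition :=
  Real.smoothTransition.contDiff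

lemma deriv_smoothTransition_eq_zero {r : ℝ} (hr : r ∉ Icc (0 : ℝ) 1) :
    deriv smoothTransition r = 0 := by
  rw [mem_Icc, not_and_or, not_le, not_le] at hr
  rcases hr with hr | hr
  · have : smoothTransition =ᶠ[𝓝 r] fun _ => 0 := by
      filter_upwards [Iio_mem_nhds hr] with x hx
      exact Real.smoothTransition.zero_of_nonpos (le_of_lt hx)
    rw [this.deriv_eq, deriv_const]
  · have : smoothTransition =ᶠ[𝓝 r] fun _ => 1 := by
      filter_upwards [Ioi_mem_nhds hr] with x hx
      exact Real.smoothTransition.one_of_one_le (le_of_lt hx)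
    rw [this.deriv_eq, deriv_const]

lemma continuous_deriv_smoothTransition : Continuous (deriv smoothTransition) :=
  contDiff_smoothTransition.continuous_deriv (by simp)

lemma hasCompactSupport_deriv_smoothTransition : HasCompactSupport (deriv smoothTransition) :=
  HasCompactSupport.intro isCompact_Icc fun _ => deriv_smoothTransition_eq_zero

lemma integral_deriv_smoothTransition : ∫ r, deriv smoothTransition r = 1 := by
  have h : ∫ r, deriv smoothTransition r = ∫ r in (0 : ℝ)..1, deriv smoothTransition r := by
    rw [intervalIntegral.integral_of_le zero_le_one, ← integral_Icc_eq_integral_Ioc]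
    exact (setIntegral_eq_integral_of_forall_compl_eq_zero fun x hx =>
      deriv_smoothTransition_eq_zero hx).symm
  rw [h, intervalIntegral.integral_deriv_eq_sub
    (fun x _ => contDiff_smoothTransition.differentiable (by simp) x)
    (continuous_deriv_smoothTransition.intervalIntegrable _ _)]
  simp [Real.smoothTransition.one, Real.smoothTransition.zero]

/-- The derivative of the smooth step has total mass 1, so its rescalings are an approximate
identity at `s`; the substitution r ↦ s + δr reduces this to dominated convergence. -/
lemma tendsto_integral_deriv_smoothTransition {a : ℝ → ℝ} (ha : Continuous a) {M : ℝ}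
    (hM : ∀ r, ‖a r‖ ≤ M) (s : ℝ) :
    Tendsto (fun δ : ℝ => ∫ r, δ⁻¹ * deriv smoothTransition (δ⁻¹ * (r - s)) * a r)
      (𝓝[>] 0) (𝓝 (a s)) := by
  have h1 : Tendsto (fun δ : ℝ => ∫ r, deriv smoothTransition r * a (s + δ * r))
      (𝓝[>] 0) (𝓝 (∫ r, deriv smoothTransition r * a s)) := by
    refine tendsto_integral_filter_of_dominated_convergence
      (fun r => ‖deriv smoothTransition r‖ * M) ?_ ?_ ?_ ?_
    · refine Eventually.of_forall fun δ => Continuous.aestronglyMeasurable ?_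
      exact continuous_deriv_smoothTransition.mul (ha.comp (by fun_prop))
    · refine Eventually.of_forall fun δ => ae_of_all _ fun r => ?_
      rw [norm_mul]
      exact mul_le_mul_of_nonneg_left (hM _) (norm_nonneg _)
    · exact ((continuous_deriv_smoothTransition.integrable_of_hasCompactSupport
        hasCompactSupport_deriv_smoothTransition).norm).mul_const _
    · refine ae_of_all _ fun r => ?_
      have : Continuous fun δ : ℝ => deriv smoothTransition r * a (s + δ * r) := by fun_prop
      simpa using (this.tendsto 0).mono_left nhdsWithin_le_nhds
  rw [integral_mul_const, integral_deriv_smoothTransition, one_mul] at h1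
  refine h1.congr' ?_
  filter_upwards [self_mem_nhdsWithin] with δ hδ
  have hδ' : (0 : ℝ) < δ := hδ
  have e := Measure.integral_comp_mul_left (fun r => deriv smoothTransition r * a (s + δ * r)) δ⁻¹
  have e2 := integral_sub_right_eq_self (μ := (volume : Measure ℝ))
    (fun r => deriv smoothTransition (δ⁻¹ * r) * a (s + δ * (δ⁻¹ * r))) s
  simp only [inv_inv, abs_of_pos hδ', smul_eq_mul] at e
  rw [e] at e2
  simp_rw [mul_assoc, integral_const_mul]
  have e3 : ∀ r, s + δ * (δ⁻¹ * (r - s)) = r := fun r => by field_simp; ring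
  simp only [e3] at e2
  rw [e2]
  field_simp

/-- The fundamental lemma for a weak derivative on `(0, T)`. -/
lemma sub_eq_intervalIntegral_of_weakDeriv {T : ℝ} (hT : 0 < T) {a b : ℝ → ℝ}
    (ha : ContinuousOn a (Icc 0 T)) (hb : IntegrableOn b (Ioo 0 T))
    (hab : ∀ χ : ℝ → ℝ, ContDiff ℝ ((⊤ : ℕ∞) : WithTop ℕ∞) χ →
      (∃ c d : ℝ, 0 < c ∧ d < T ∧ ∀ t, t ∉ Icc c d → χ t = 0) →
      ∫ t in Ioo 0 T, (deriv χ t * a t + χ t * b t) = 0)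
    {s t : ℝ} (hs : s ∈ Icc 0 T) (ht : t ∈ Icc 0 T) :
    a t - a s = ∫ r in s..t, b r := by
  have hbI : IntegrableOn b (Icc 0 T) := by rwa [integrableOn_Icc_iff_integrableOn_Ioo]
  have hbi : ∀ s ∈ Icc 0 T, ∀ t ∈ Icc 0 T, IntervalIntegrable b volume s t := fun s hs t ht =>
    (hbI.mono_set (ordConnected_Icc.uIcc_subset hs ht)).intervalIntegrable
  -- Clamping the argument extends `a` to a bounded continuous function on the line.
  set A : ℝ → ℝ := fun r => a (projIcc 0 T hT.le r) with hA
  have hAc : Continuous A := ha.domRestrict.comp continuous_projIcc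
  have hAa : ∀ r ∈ Icc 0 T, A r = a r := fun r hr => by simp [hA, projIcc_of_mem hT.le hr]
  obtain ⟨M, hM⟩ := isCompact_Icc.exists_bound_of_continuousOn ha
  have hAM : ∀ r, ‖A r‖ ≤ M := fun r => hM _ (projIcc 0 T hT.le r).2
  have key : ∀ s ∈ Ioo 0 T, ∀ t ∈ Ioo 0 T, s ≤ t → a t - a s = ∫ r in s..t, b r := by
    intro s hs t ht hst
    -- A smooth approximation of the indicator of (s,t], rising just after `s` and falling just
    -- after `t`. Its support lies in [s, t + δ], inside (0,T) for small δ.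
    set χ : ℝ → ℝ → ℝ := fun δ r =>
      smoothTransition (δ⁻¹ * (r - s)) - smoothTransition (δ⁻¹ * (r - t)) with hχ
    have hderiv : ∀ (δ : ℝ) (p : ℝ) r, HasDerivAt (fun r => smoothTransition (δ⁻¹ * (r - p)))
        (δ⁻¹ * deriv smoothTransition (δ⁻¹ * (r - p))) r := fun δ p r => by
      have h1 : HasDerivAt (fun r => δ⁻¹ * (r - p)) δ⁻¹ r := by
        simpa using ((hasDerivAt_id r).sub_const p).const_mul δ⁻¹
      have h2 := (contDiff_smoothTransition.differentiable (by simp)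
        (δ⁻¹ * (r - p))).hasDerivAt.comp r h1
      rwa [mul_comm] at h2
    have hsupp : ∀ δ > 0, ∀ p r, r ∉ Icc p (p + δ) → deriv smoothTransition (δ⁻¹ * (r - p)) = 0 := by
      intro δ hδ p r hr
      refine deriv_smoothTransition_eq_zero fun h => hr ⟨?_, ?_⟩
      · have := (mul_nonneg_iff_of_pos_left (inv_pos.2 hδ)).1 h.1
        linarith
      · have := h.2
        rw [inv_mul_le_iff₀ hδ] at this
        linarith
    have hz : ∀ δ > 0, ∀ r, r ∉ Icc s (t + δ) → χ δ r = 0 := by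
      intro δ hδ r hr
      rw [mem_Icc, not_and_or, not_le, not_le] at hr
      rcases hr with hr | hr
      · simp only [hχ]
        rw [Real.smoothTransition.zero_of_nonpos, Real.smoothTransition.zero_of_nonpos, sub_zero]
        · exact mul_nonpos_of_nonneg_of_nonpos (inv_pos.2 hδ).le (by linarith)
        · exact mul_nonpos_of_nonneg_of_nonpos (inv_pos.2 hδ).le (by linarith)
      · simp only [hχ]
        rw [Real.smoothTransition.one_of_one_le, Real.smoothTransition.one_of_one_le, sub_self]
        · rw [le_inv_mul_iff₀ hδ]; linarith
        · rw [le_inv_mul_iff₀ hδ]; linarith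
    have hsmall : ∀ᶠ δ : ℝ in 𝓝[>] 0, 0 < δ ∧ δ < T - t := by
      filter_upwards [Ioo_mem_nhdsGT (show (0 : ℝ) < T - t by linarith [ht.2])] with δ hδ
      exact hδ
    have hL1 := (tendsto_integral_deriv_smoothTransition hAc hAM s).sub
      (tendsto_integral_deriv_smoothTransition hAc hAM t)
    have hL2 : Tendsto (fun δ : ℝ => ∫ r in Ioo 0 T, χ δ r * b r) (𝓝[>] 0)
        (𝓝 (∫ r in Ioo 0 T, (Ioc s t).indicator b r)) := by
      refine tendsto_integral_filter_of_dominated_convergence (fun r => ‖b r‖) ?_ ?_ hb.norm ?_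
      · refine Eventually.of_forall fun δ => AEStronglyMeasurable.mul ?_ hb.aestronglyMeasurable
        refine Continuous.aestronglyMeasurable ?_
        have := contDiff_smoothTransition.continuous
        fun_prop
      · refine Eventually.of_forall fun δ => ae_of_all _ fun r => ?_
        rw [norm_mul]
        refine mul_le_of_le_one_left (norm_nonneg _) ?_
        rw [Real.norm_eq_abs, abs_le]
        constructor <;> simp only [hχ] <;>
        linarith [Real.smoothTransition.nonneg (δ⁻¹ * (r - s)),
          Real.smoothTransition.le_one (δ⁻¹ * (r - s)),
          Real.smoothTransition.nonneg (δ⁻¹ * (r - t)),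
          Real.smoothTransition.le_one (δ⁻¹ * (r - t))]
      · refine ae_of_all _ fun r => ?_
        refine tendsto_const_nhds.congr' ?_
        have hone : ∀ p, p < r → ∀ᶠ δ : ℝ in 𝓝[>] 0, smoothTransition (δ⁻¹ * (r - p)) = 1 := by
          intro p hp
          filter_upwards [Ioo_mem_nhdsGT (show (0 : ℝ) < r - p by linarith)] with δ hδ
          refine Real.smoothTransition.one_of_one_le ?_
          rw [le_inv_mul_iff₀ hδ.1]; linarith [hδ.2]
        have hzero : ∀ p, r ≤ p → ∀ᶠ δ : ℝ in 𝓝[>] 0, smoothTransition (δ⁻¹ * (r - p)) = 0 := by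
          intro p hp
          filter_upwards [self_mem_nhdsWithin] with δ hδ
          refine Real.smoothTransition.zero_of_nonpos ?_
          exact mul_nonpos_of_nonneg_of_nonpos (inv_pos.2 hδ).le (by linarith)
        rcases le_or_gt r s with h1 | h1
        · filter_upwards [hzero s h1, hzero t (h1.trans hst)] with δ e1 e2
          simp only [hχ, e1, e2]
          rw [indicator_of_notMem fun h => h1.not_gt h.1]; simp
        rcases le_or_gt r t with h2 | h2
        · filter_upwards [hone s h1, hzero t h2] with δ e1 e2
          simp only [hχ, e1, e2]
          rw [indicator_of_mem (show r ∈ Ioc s t from ⟨h1, h2⟩)]; simp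
        · filter_upwards [hone s h1, hone t h2] with δ e1 e2
          simp only [hχ, e1, e2]
          rw [indicator_of_notMem fun h => h2.not_ge h.2]; simp
    have hsum := hL1.add hL2
    have hev : (fun _ : ℝ => (0 : ℝ)) =ᶠ[𝓝[>] 0] fun δ : ℝ =>
        (∫ r, δ⁻¹ * deriv smoothTransition (δ⁻¹ * (r - s)) * A r)
        - (∫ r, δ⁻¹ * deriv smoothTransition (δ⁻¹ * (r - t)) * A r)
        + ∫ r in Ioo 0 T, χ δ r * b r := by
      filter_upwards [hsmall] with δ hδ
      have hcont : ∀ p, Continuous fun r => δ⁻¹ * deriv smoothTransition (δ⁻¹ * (r - p)) := fun p => by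
        have := continuous_deriv_smoothTransition
        fun_prop
      have hrestr : ∀ p, 0 < p → p ≤ t →
          ∫ r, δ⁻¹ * deriv smoothTransition (δ⁻¹ * (r - p)) * A r
          = ∫ r in Ioo 0 T, δ⁻¹ * deriv smoothTransition (δ⁻¹ * (r - p)) * a r := by
        intro p hp hpt
        have : ∫ r in Ioo 0 T, δ⁻¹ * deriv smoothTransition (δ⁻¹ * (r - p)) * a r
            = ∫ r in Ioo 0 T, δ⁻¹ * deriv smoothTransition (δ⁻¹ * (r - p)) * A r :=
          setIntegral_congr_fun measurableSet_Ioo fun r hr => by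
            simp only [hAa r (Ioo_subset_Icc_self hr)]
        rw [this]
        refine (setIntegral_eq_integral_of_forall_compl_eq_zero fun r hr => ?_).symm
        rw [hsupp δ hδ.1 p r fun h => hr ⟨by linarith [h.1], by linarith [h.2, hδ.2]⟩]
        ring
      have hint : ∀ p, IntegrableOn
          (fun r => δ⁻¹ * deriv smoothTransition (δ⁻¹ * (r - p)) * a r) (Ioo 0 T) := fun p =>
        (((hcont p).continuousOn.mul ha).integrableOn_Icc).mono_set Ioo_subset_Icc_self
      have hχb : IntegrableOn (fun r => χ δ r * b r) (Ioo 0 T) := by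
        refine Integrable.bdd_mul (c := 2) hb ?_ (ae_of_all _ fun r => ?_)
        · refine Continuous.aestronglyMeasurable ?_
          have := contDiff_smoothTransition.continuous
          fun_prop
        · rw [Real.norm_eq_abs, abs_le]
          constructor <;> simp only [hχ] <;>
          linarith [Real.smoothTransition.nonneg (δ⁻¹ * (r - s)),
            Real.smoothTransition.le_one (δ⁻¹ * (r - s)),
            Real.smoothTransition.nonneg (δ⁻¹ * (r - t)),
            Real.smoothTransition.le_one (δ⁻¹ * (r - t))]
      rw [hrestr s hs.1 hst, hrestr t ht.1 le_rfl, ← integral_sub' (hint s) (hint t),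
        ← integral_add' ((hint s).sub (hint t)) hχb]
      have hχs : ContDiff ℝ ((⊤ : ℕ∞) : WithTop ℕ∞) (χ δ) :=
        (contDiff_smoothTransition.comp (by fun_prop)).sub
          (contDiff_smoothTransition.comp (by fun_prop))
      refine (hab (χ δ) hχs ⟨s, t + δ, hs.1, by linarith [hδ.2], hz δ hδ.1⟩).symm.trans ?_
      refine integral_congr_ae (ae_of_all _ fun r => ?_)
      have hd : deriv (χ δ) r = δ⁻¹ * deriv smoothTransition (δ⁻¹ * (r - s))
          - δ⁻¹ * deriv smoothTransition (δ⁻¹ * (r - t)) :=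
        ((hderiv δ s r).sub (hderiv δ t r)).deriv
      simp only [hd, sub_mul, Pi.add_apply, Pi.sub_apply]
    have hfin := tendsto_nhds_unique (tendsto_const_nhds.congr' hev) hsum
    rw [setIntegral_indicator measurableSet_Ioc,
      inter_eq_right.2 (show Ioc s t ⊆ Ioo 0 T from
        fun r hr => ⟨hs.1.trans hr.1, hr.2.trans_lt ht.2⟩),
      hAa s (Ioo_subset_Icc_self hs), hAa t (Ioo_subset_Icc_self ht)] at hfin
    rw [intervalIntegral.integral_of_le hst]
    linarith
  have hprim : ContinuousOn (fun r => a r - ∫ x in (0 : ℝ)..r, b x) (Icc 0 T) :=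
    ha.sub (by
      have := intervalIntegral.continuousOn_primitive_interval (μ := volume) (f := b)
        (a := 0) (b := T) (by rwa [uIcc_of_le hT.le])
      rwa [uIcc_of_le hT.le] at this)
  have h0 : (0 : ℝ) ∈ Icc 0 T := ⟨le_rfl, hT.le⟩
  have hm : T / 2 ∈ Ioo 0 T := ⟨by linarith, by linarith⟩
  -- On the open interval `a` minus a primitive of `b` is constant; continuity carries this to both
  -- endpoints.
  have hconst : EqOn (fun r => a r - ∫ x in (0 : ℝ)..r, b x)
      (fun _ => a (T / 2) - ∫ x in (0 : ℝ)..(T / 2), b x) (Icc 0 T) := by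
    refine EqOn.of_subset_closure (s := Ioo 0 T) (fun r hr => ?_) hprim continuousOn_const
      Ioo_subset_Icc_self (by rw [closure_Ioo hT.ne])
    have hr' := Ioo_subset_Icc_self hr
    have hm' := Ioo_subset_Icc_self hm
    have hadd := intervalIntegral.integral_add_adjacent_intervals (hbi 0 h0 _ hm') (hbi _ hm' r hr')
    have hrm : a r - a (T / 2) = ∫ x in (T / 2)..r, b x := by
      rcases le_total r (T / 2) with h | h
      · rw [intervalIntegral.integral_symm, ← key r hr _ hm h]; ring
      · exact key _ hm r hr h
    linarith
  have e1 := hconst hs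
  have e2 := hconst ht
  have hadd := intervalIntegral.integral_add_adjacent_intervals (hbi 0 h0 s hs) (hbi s hs t ht)
  simp only at e1 e2
  linarith

end DuBoisReymond

/-! ### Kernels of small support, viewed on the torus, and flux bounds. -/

section TorusKernel

instance : (volume : Measure T3).IsNegInvariant :=
  Measure.IsAddHaarMeasure.isNegInvariant_of_regular _

/-- The lower corner of the unit cube centred at the origin. -/
def centre : E3 := WithLp.toLp 2 fun _ => -(1 / 2)

/-- The section of `toTorus` with values in the centred unit cube. -/
def torusSection (z : T3) : E3 :=
  WithLp.toLp 2 fun i => (AddCircle.measurableEquivIoc (1 : ℝ) (-(1 / 2)) (z i) : ℝ)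

lemma measurable_torusSection : Measurable torusSection := by
  refine (WithLp.measurable_toLp 2 _).comp (measurable_pi_lambda _ fun i => ?_)
  exact measurable_subtype_coe.comp
    ((AddCircle.measurableEquivIoc (1 : ℝ) (-(1 / 2))).measurable.comp (measurable_pi_apply i))

lemma torusSection_toTorus {y : E3} (hy : y ∈ cube centre) : torusSection (toTorus y) = y := by
  ext i
  have := hy i
  simp only [centre] at this
  exact AddCircle.equivIoc_coe_of_mem (p := (1 : ℝ)) this

/-- A kernel supported in one fundamental cube descends to a bounded function on the torus. The
convolution at a point becomes a pairing with one fixed function, to which weak continuity can be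
applied. -/
lemma exists_torusKernel {D : E3 → ℝ} (hD : Continuous D) (hsupp : ∀ y, y ∉ cube centre → D y = 0)
    {C : ℝ} (hC : ∀ y, |D y| ≤ C) :
    ∃ w : T3 → ℝ, Measurable w ∧ (∀ z, |w z| ≤ C) ∧
      ∀ f : T3 → ℝ, Integrable f volume → ∀ x, conv D f x = ∫ z, w (x - z) * f z := by
  have hw : Measurable fun z => D (torusSection z) := hD.measurable.comp measurable_torusSection
  refine ⟨fun z => D (torusSection z), hw, fun z => hC _, fun f hf x => ?_⟩
  have h1 : conv D f x = ∫ y in cube centre, D y * f (x - toTorus y) :=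
    (setIntegral_eq_integral_of_forall_compl_eq_zero fun y hy => by rw [hsupp y hy, zero_mul]).symm
  have hmeas : MeasurableSet (cube centre) := by
    simp only [cube, ofPred_forall]
    exact MeasurableSet.iInter fun i => measurableSet_Ioc.preimage (by fun_prop)
  have h2 : ∫ y in cube centre, D y * f (x - toTorus y)
      = ∫ y in cube centre, D (torusSection (toTorus y)) * f (x - toTorus y) :=
    setIntegral_congr_fun hmeas fun y hy => by simp only [torusSection_toTorus hy]
  have hmp := measurePreserving_toTorus centre
  have hf' : AEStronglyMeasurable (fun z => f (x - z)) volume :=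
    hf.1.comp_measurePreserving (Measure.measurePreserving_sub_left volume x)
  have h3 : ∫ y in cube centre, D (torusSection (toTorus y)) * f (x - toTorus y)
      = ∫ z, D (torusSection z) * f (x - z) := by
    rw [← integral_map (f := fun z => D (torusSection z) * f (x - z))
      hmp.measurable.aemeasurable (by
        rw [hmp.map_eq]; exact hw.aestronglyMeasurable.mul hf'), hmp.map_eq]
  rw [h1, h2, h3, ← integral_sub_left_eq_self _ volume x]
  simp

variable {K : E3 → ℝ}

lemma mem_cube_of_norm_le {y : E3} (hy : ‖y‖ ≤ 1 / 4) : y ∈ cube centre := by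
  intro i
  have := (PiLp.norm_apply_le y i).trans hy
  rw [Real.norm_eq_abs, abs_le] at this
  simp only [centre]
  constructor <;> linarith

lemma kernelDeriv_eq_zero (hs : tsupport K ⊆ Metric.closedBall 0 (1 / 4)) (i : Fin 3) (y : E3)
    (hy : y ∉ cube centre) : kernelDeriv i K y = 0 := by
  have : y ∉ tsupport K := fun h => hy (mem_cube_of_norm_le (by simpa using hs h))
  have h2 : fderiv ℝ K y = 0 := by
    by_contra h
    exact this (support_fderiv_subset ℝ h)
  simp [kernelDeriv, h2]

lemma IsKernel.exists_kernelDeriv_bound (hK : IsKernel K) :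
    ∃ C, ∀ i y, |EMHD.kernelDeriv i K y| ≤ C := by
  have h : ∀ i, ∃ C, ∀ y, |EMHD.kernelDeriv i K y| ≤ C := fun i =>
    (hK.kernelDeriv i).compact.exists_bound_of_continuous (hK.kernelDeriv i).continuous
  choose C hC using h
  exact ⟨∑ i, |C i|, fun i y => ((hC i y).trans (le_abs_self _)).trans
    (Finset.single_le_sum (f := fun i => |C i|) (fun i _ => abs_nonneg _) (Finset.mem_univ i))⟩

lemma abs_apply_le (v : E3) (i : Fin 3) : |v i| ≤ ‖v‖ := PiLp.norm_apply_le v i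

lemma abs_mul_apply_le (v : E3) (i k : Fin 3) : |v i * v k| ≤ ‖v‖ ^ 2 := by
  rw [abs_mul, sq]
  exact mul_le_mul (abs_apply_le v i) (abs_apply_le v k) (abs_nonneg _) (norm_nonneg _)

lemma integrable_mul_apply {u : T3 → E3} (hu : MemLp u 2 volume) (i k : Fin 3) :
    Integrable (fun x => u x i * u x k) volume :=
  (hu.eval_piLp i).integrable_mul (hu.eval_piLp k)

lemma integrable_inner_of_memLp {u v : T3 → E3} (hu : MemLp u 2 volume) (hv : MemLp v 2 volume) :
    Integrable (fun x => inner ℝ (u x) (v x)) volume := by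
  simp_rw [inner_eq_sum]
  exact integrable_finsetSum _ fun i _ => (hu.eval_piLp i).integrable_mul (hv.eval_piLp i)

/-- On a probability space the L¹ norm is at most 1 + M, because |v| ≤ 1 + |v|²; the kernel
contributes its supremum. -/
lemma abs_conv_kernelDeriv_le (hK : IsKernel K) (hs : tsupport K ⊆ Metric.closedBall 0 (1 / 4))
    {C : ℝ} (hC : ∀ i y, |kernelDeriv i K y| ≤ C) {u : T3 → E3} (hu : MemLp u 2 volume)
    {M : ℝ} (hM : ∫ x, ‖u x‖ ^ 2 ≤ M) (i k : Fin 3) (x : T3) :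
    |conv (kernelDeriv i K) (fun z => u z k) x| ≤ C * (1 + M) := by
  have hC0 : 0 ≤ C := (abs_nonneg _).trans (hC 0 0)
  obtain ⟨w, hw, hwC, hwe⟩ := exists_torusKernel (hK.kernelDeriv i).continuous
    (kernelDeriv_eq_zero hs i) (hC i)
  have hI := hu.integrable (by norm_num)
  have hsq : Integrable (fun x => ‖u x‖ ^ 2) volume := hu.integrable_norm_pow (by norm_num)
  rw [hwe _ (hI.eval_piLp k), ← Real.norm_eq_abs]
  refine (norm_integral_le_of_norm_le (g := fun z => C * (1 + ‖u z‖ ^ 2))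
    (((integrable_const 1).add hsq).const_mul C) (ae_of_all _ fun z => ?_)).trans ?_
  · rw [norm_mul, Real.norm_eq_abs, Real.norm_eq_abs]
    refine mul_le_mul (hwC _) ((abs_apply_le _ _).trans ?_) (abs_nonneg _) hC0
    nlinarith [sq_nonneg (‖u z‖ - 1)]
  · rw [integral_const_mul, integral_add (integrable_const 1) hsq]
    refine mul_le_mul_of_nonneg_left ?_ hC0
    simpa using hM

lemma abs_flux_le (hK : IsKernel K) (hs : tsupport K ⊆ Metric.closedBall 0 (1 / 4))
    {C : ℝ} (hC : ∀ i y, |kernelDeriv i K y| ≤ C) {u v : T3 → E3} (hu : MemLp u 2 volume)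
    (hv : MemLp v 2 volume) {M : ℝ} (huM : ∫ x, ‖u x‖ ^ 2 ≤ M) (hvM : ∫ x, ‖v x‖ ^ 2 ≤ M) :
    |flux K u v| ≤ 9 * (M * (C * (1 + M))) := by
  have hC0 : 0 ≤ C := (abs_nonneg _).trans (hC 0 0)
  have hM0 : 0 ≤ M := (integral_nonneg fun x => sq_nonneg _).trans huM
  have hsq : Integrable (fun x => ‖u x‖ ^ 2) volume := hu.integrable_norm_pow (by norm_num)
  have h1 : ∀ i k, |∫ x, u x i * u x k * conv (kernelDeriv i K) (fun z => v z k) x|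
      ≤ M * (C * (1 + M)) := fun i k => by
    rw [← Real.norm_eq_abs]
    refine (norm_integral_le_of_norm_le (hsq.mul_const (C * (1 + M)))
      (ae_of_all _ fun x => ?_)).trans ?_
    · rw [norm_mul]
      exact mul_le_mul (abs_mul_apply_le _ _ _) (abs_conv_kernelDeriv_le hK hs hC hv hvM i k x)
        (abs_nonneg _) (sq_nonneg _)
    · rw [integral_mul_const]
      exact mul_le_mul_of_nonneg_right huM (by positivity)
  calc |flux K u v| ≤ ∑ i : Fin 3, ∑ k : Fin 3, M * (C * (1 + M)) :=
        (Finset.abs_sum_le_sum_abs _ _).trans (Finset.sum_le_sum fun i _ =>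
          (Finset.abs_sum_le_sum_abs _ _).trans (Finset.sum_le_sum fun k _ => h1 i k))
    _ = 9 * (M * (C * (1 + M))) := by simp; ring

end TorusKernel

/-! ### The weak equation tested against frozen mollified fields. -/

section Evolution

variable {T : ℝ} {h : ℝ → T3 → E3} {K : E3 → ℝ}

/-- The uniform boundedness principle for the functionals w ↦ ∫ h(t) · w, which are pointwise
bounded as weakly continuous functions on a compact interval. -/
lemma IsWeakSolution.exists_energy_bound (hsol : IsWeakSolution T h) :
    ∃ M, ∀ t ∈ Icc 0 T, ∫ x, ‖h t x‖ ^ 2 ≤ M := by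
  let g : Icc (0 : ℝ) T → (Lp E3 2 (volume : Measure T3) →L[ℝ] ℝ) := fun t =>
    innerSL ℝ (hsol.memLp t t.2).toLp
  have hg : ∀ (t : Icc (0 : ℝ) T) (w : Lp E3 2 (volume : Measure T3)),
      g t w = ∫ x, inner ℝ (h t x) (w x) := fun t w => by
    simp only [g, innerSL_apply_apply, L2.inner_def]
    refine integral_congr_ae ?_
    filter_upwards [(hsol.memLp t t.2).coeFn_toLp] with x hx
    rw [hx]
  obtain ⟨C, hC⟩ := banach_steinhaus (g := g) fun w => by
    obtain ⟨C, hC⟩ := isCompact_Icc.exists_bound_of_continuousOn (hsol.weakCont w (Lp.memLp w))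
    exact ⟨C, fun t => by rw [hg]; exact hC t t.2⟩
  refine ⟨C ^ 2, fun t ht => ?_⟩
  have h1 := hC ⟨t, ht⟩
  simp only [g, innerSL_apply_norm] at h1
  have h2 : ∫ x, ‖h t x‖ ^ 2 = ‖(hsol.memLp t ht).toLp‖ ^ 2 := by
    rw [← real_inner_self_eq_norm_sq, L2.inner_def]
    refine integral_congr_ae ?_
    filter_upwards [(hsol.memLp t ht).coeFn_toLp] with x hx
    rw [hx, real_inner_self_eq_norm_sq]
  rw [h2]
  exact pow_le_pow_left₀ (norm_nonneg _) h1 2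

lemma IsWeakSolution.continuousOn_conv (hsol : IsWeakSolution T h) (hK : IsKernel K)
    (hs : tsupport K ⊆ Metric.closedBall 0 (1 / 4)) (i k : Fin 3) (x : T3) :
    ContinuousOn (fun t => conv (kernelDeriv i K) (fun z => h t z k) x) (Icc 0 T) := by
  obtain ⟨C, hC⟩ := hK.exists_kernelDeriv_bound
  obtain ⟨w, hw, hwC, hwe⟩ := exists_torusKernel (hK.kernelDeriv i).continuous
    (kernelDeriv_eq_zero hs i) (hC i)
  have hW : MemLp (fun z => (EuclideanSpace.single k (w (x - z)) : E3)) 2 volume := by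
    refine MemLp.of_eval_piLp fun j => ?_
    by_cases hj : j = k
    · subst hj
      simpa using MemLp.of_bound (f := fun z => w (x - z))
        ((hw.comp (measurable_const.sub measurable_id)).aestronglyMeasurable) C
        (ae_of_all _ fun z => hwC (x - z))
    · simp [hj]
  refine (hsol.weakCont _ hW).congr fun t ht => ?_
  simp only
  rw [hwe _ (((hsol.memLp t ht).integrable (by norm_num)).eval_piLp k)]
  refine integral_congr_ae (ae_of_all _ fun z => ?_)
  simp [EuclideanSpace.inner_single_right]

/-- The mollified factor converges pointwise in `x` and is uniformly bounded, so dominated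
convergence applies. Continuity is claimed in the mollified slot only: the other slot is quadratic,
and weak continuity does not pass to products. -/
lemma IsWeakSolution.continuousOn_flux (hsol : IsWeakSolution T h) (hK : IsKernel K)
    (hs : tsupport K ⊆ Metric.closedBall 0 (1 / 4)) {u : T3 → E3} (hu : MemLp u 2 volume) :
    ContinuousOn (fun t => flux K u (h t)) (Icc 0 T) := by
  obtain ⟨M, hM⟩ := hsol.exists_energy_bound
  obtain ⟨C, hC⟩ := hK.exists_kernelDeriv_bound
  refine continuousOn_finsetSum _ fun i _ => continuousOn_finsetSum _ fun k _ => ?_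
  refine continuousOn_of_dominated (bound := fun x => |u x i * u x k| * (C * (1 + M)))
    (fun t ht => ?_) (fun t ht => ae_of_all _ fun x => ?_) ?_ (ae_of_all _ fun x => ?_)
  · exact ((hK.kernelDeriv i).integrable_mul_conv (integrable_mul_apply hu i k)
      (((hsol.memLp t ht).integrable (by norm_num)).eval_piLp k)).1
  · rw [norm_mul]
    exact mul_le_mul_of_nonneg_left
      (abs_conv_kernelDeriv_le hK hs hC (hsol.memLp t ht) (hM t ht) i k x) (norm_nonneg _)
  · exact (integrable_mul_apply hu i k).abs.mul_const _
  · exact continuousOn_const.mul (hsol.continuousOn_conv hK hs i k x)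

lemma aestronglyMeasurable_flux
    (hm : AEStronglyMeasurable (fun z : ℝ × T3 => h z.1 z.2) ((volume.restrict (Ioo 0 T)).prod volume))
    (hK : IsKernel K) {v : T3 → E3} (hv : Integrable v volume) :
    AEStronglyMeasurable (fun t => flux K (h t) v) (volume.restrict (Ioo 0 T)) := by
  have hmi : ∀ i : Fin 3, AEStronglyMeasurable (fun z : ℝ × T3 => h z.1 z.2 i)
      ((volume.restrict (Ioo 0 T)).prod volume) := fun i =>
    (EuclideanSpace.proj (𝕜 := ℝ) i).continuous.comp_aestronglyMeasurable hm
  refine Finset.aestronglyMeasurable_fun_sum _ fun i _ =>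
    Finset.aestronglyMeasurable_fun_sum _ fun k _ => ?_
  refine AEStronglyMeasurable.integral_prod_right'
    (f := fun z : ℝ × T3 => h z.1 z.2 i * h z.1 z.2 k * conv (kernelDeriv i K) (fun z => v z k) z.2) ?_
  refine ((hmi i).mul (hmi k)).mul (Continuous.aestronglyMeasurable ?_)
  exact ((hK.kernelDeriv i).isSmooth_conv (hv.eval_piLp k)).continuous.comp continuous_snd

/-- The weak formulation, integrated in time against a mollified potential. -/
lemma IsWeakSolution.integral_sub_integral (hT : 0 < T) (hsol : IsWeakSolution T h)
    (hm : AEStronglyMeasurable (fun z : ℝ × T3 => h z.1 z.2) ((volume.restrict (Ioo 0 T)).prod volume))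
    (hK : IsKernel K) (hs : tsupport K ⊆ Metric.closedBall 0 (1 / 4))
    {G v : T3 → E3} (hG : IsWeaklyDivFree G) (hGv : IsWeakCurl G v) (hv : MemLp v 2 volume)
    {s t : ℝ} (hs0 : s ∈ Icc 0 T) (ht0 : t ∈ Icc 0 T) :
    (∫ x, inner ℝ (h t x) (vconv K G x)) - ∫ x, inner ℝ (h s x) (vconv K G x)
      = ∫ r in s..t, flux K (h r) v := by
  obtain ⟨M, hM⟩ := hsol.exists_energy_bound
  obtain ⟨C, hC⟩ := hK.exists_kernelDeriv_bound
  have hψ : IsSmooth (vconv K G) := hK.vconv_smooth hG.1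
  refine sub_eq_intervalIntegral_of_weakDeriv (a := fun t => ∫ x, inner ℝ (h t x) (vconv K G x)) hT
    (hsol.weakCont _ (hψ.memLp 2)) ?_ ?_ hs0 ht0
  · refine Integrable.of_bound (aestronglyMeasurable_flux hm hK hGv.2.1)
      (9 * (max M (∫ x, ‖v x‖ ^ 2) * (C * (1 + max M (∫ x, ‖v x‖ ^ 2))))) ?_
    filter_upwards [ae_restrict_mem measurableSet_Ioo] with r hr
    have hr' := Ioo_subset_Icc_self hr
    exact abs_flux_le hK hs hC (hsol.memLp r hr') hv ((hM r hr').trans (le_max_left _ _))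
      (le_max_right _ _)
  · intro χ hχ hχs
    have htest : IsTestField T fun t x => χ t • vconv K G x := by
      refine ⟨?_, ?_, fun t x => ?_⟩
      · exact (hχ.comp contDiff_fst).smul (ContDiff.comp (g := fun y : E3 => vconv K G (toTorus y))
          hψ contDiff_snd)
      · obtain ⟨c, d, hc, hd, hcd⟩ := hχs
        exact ⟨c, d, hc, hd, fun t ht x => by rw [hcd t ht, zero_smul]⟩
      · have := hK.divergence_vconv hG x
        simp only [divergence, PiLp.smul_apply, smul_eq_mul, partialDeriv_const_mul] at this ⊢
        rw [← Finset.mul_sum, this, mul_zero]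
    refine Eq.trans ?_ (hsol.equation _ htest)
    refine setIntegral_congr_fun measurableSet_Ioo fun r hr => ?_
    have hL := hsol.memLp r (Ioo_subset_Icc_self hr)
    have hLi := hL.integrable (by norm_num)
    have hd : ∀ x, deriv (fun s => χ s • vconv K G x) r = deriv χ r • vconv K G x := fun x =>
      ((hχ.differentiable (by simp) r).hasDerivAt.smul_const _).deriv
    -- The curl of the mollified potential is the mollified field, which turns the Hall term into
    -- the flux.
    have hcurl : ∀ x, curl (fun z => χ r • vconv K G z) x = χ r • vconv K v x := fun x => by
      rw [← hK.curl_vconv hGv]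
      ext k
      simp only [curl_apply, PiLp.smul_apply, smul_eq_mul, partialDeriv_const_mul]
      ring
    have hp : ∀ i k x, partialDeriv i (fun z => curl (fun z => χ r • vconv K G z) z k) x
        = χ r * conv (kernelDeriv i K) (fun z => v z k) x := fun i k x => by
      simp only [hcurl, PiLp.smul_apply, smul_eq_mul, partialDeriv_const_mul, vconv_apply]
      rw [← hK.partialDeriv_conv (hGv.2.1.eval_piLp k)]
    have hin : ∀ i k, Integrable (fun x => h r x i * h r x k
        * conv (kernelDeriv i K) (fun z => v z k) x) volume := fun i k =>
      (hK.kernelDeriv i).integrable_mul_conv (integrable_mul_apply hL i k) (hGv.2.1.eval_piLp k)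
    have hinner : Integrable (fun x => inner ℝ (h r x) (vconv K G x)) volume :=
      integrable_inner_of_memLp hL (hψ.memLp 2)
    simp only [hd, hp, inner_smul_right]
    have hrw : ∀ x, ∑ i, ∑ k, h r x i * h r x k * (χ r * conv (kernelDeriv i K) (fun z => v z k) x)
        = χ r * ∑ i, ∑ k, h r x i * h r x k * conv (kernelDeriv i K) (fun z => v z k) x := fun x => by
      simp_rw [Finset.mul_sum]
      refine Finset.sum_congr rfl fun i _ => Finset.sum_congr rfl fun k _ => by ring
    simp_rw [hrw]
    rw [integral_add (hinner.const_mul _)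
      ((integrable_finsetSum _ fun i _ => integrable_finsetSum _ fun k _ => hin i k).const_mul _),
      integral_const_mul, integral_const_mul,
      integral_finsetSum _ fun i _ => integrable_finsetSum _ fun k _ => hin i k]
    simp_rw [integral_finsetSum _ fun k _ => hin _ k]
    rfl

end Evolution

/-! ### Passing from frozen to diagonal time arguments. -/

section Telescoping

lemma abs_mul_floor_sub_le {d r : ℝ} (hd : 0 < d) (hr : 0 ≤ r) :
    d * ⌊r / d⌋₊ ≤ r ∧ r ≤ d * ⌊r / d⌋₊ + d := by
  have h1 := Nat.floor_le (div_nonneg hr hd.le)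
  have h2 := (Nat.lt_floor_add_one (r / d)).le
  rw [le_div_iff₀ hd] at h1
  rw [div_le_iff₀ hd] at h2
  constructor <;> linarith

/-- If the increments of `G` are given by integrals of a kernel `F` frozen at the endpoints, then
they are given by the integral of its diagonal. -/
lemma sub_eq_integral_diagonal {t : ℝ} (ht : 0 ≤ t) {G : ℝ → ℝ} {F : ℝ → ℝ → ℝ} {C : ℝ}
    (hG : ∀ a ∈ Icc 0 t, ∀ b ∈ Icc 0 t, a ≤ b → G b - G a = ∫ r in a..b, (F r a + F r b))
    (hmeas : ∀ s ∈ Icc 0 t, AEStronglyMeasurable (fun r => F r s) (volume.restrict (Ioc 0 t)))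
    (hbd : ∀ r ∈ Icc 0 t, ∀ s ∈ Icc 0 t, |F r s| ≤ C)
    (hcont : ∀ r ∈ Icc 0 t, ContinuousOn (F r) (Icc 0 t)) :
    G t - G 0 = ∫ r in (0 : ℝ)..t, 2 * F r r := by
  rcases ht.eq_or_lt with rfl | ht'
  · simp
  set d : ℕ → ℝ := fun N => t / (N + 1) with hd
  have hdpos : ∀ N, 0 < d N := fun N => by positivity
  have hdlim : Tendsto d atTop (𝓝 0) := by
    have := (tendsto_one_div_add_atTop_nhds_zero_nat (𝕜 := ℝ)).const_mul t
    simpa [hd, div_eq_mul_inv] using this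
  have hdN : ∀ N : ℕ, d N * ((N + 1 : ℕ) : ℝ) = t := fun N => by
    simp only [hd]; push_cast; field_simp
  -- The left endpoint of the cell containing `r`. In `g` the right endpoint is capped at `t`: at r
  -- = t the floor is already N + 1, and l + d would leave [0,t].
  set l : ℕ → ℝ → ℝ := fun N r => d N * ⌊r / d N⌋₊ with hl
  set g : ℕ → ℝ → ℝ := fun N r => F r (l N r) + F r (min (l N r + d N) t) with hg
  have hpmem : ∀ N i : ℕ, i ≤ N + 1 → d N * (i : ℝ) ∈ Icc 0 t := fun N i hi => by
    refine ⟨by have := hdpos N; positivity, ?_⟩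
    rw [← hdN N]
    exact mul_le_mul_of_nonneg_left (by exact_mod_cast hi) (hdpos N).le
  -- Open cells, because the floor jumps at the right endpoint; the missing points are null.
  have hgcell : ∀ N i : ℕ, i < N + 1 → ∀ r ∈ Ioo (d N * (i : ℝ)) (d N * ((i + 1 : ℕ) : ℝ)),
      g N r = F r (d N * i) + F r (d N * ((i + 1 : ℕ) : ℝ)) := by
    intro N i hi r hr
    have hfl : ⌊r / d N⌋₊ = i := by
      rw [Nat.floor_eq_iff (div_nonneg ((hpmem N i hi.le).1.trans hr.1.le) (hdpos N).le)]
      refine ⟨?_, ?_⟩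
      · rw [le_div_iff₀ (hdpos N)]; linarith [hr.1]
      · rw [div_lt_iff₀ (hdpos N)]; have := hr.2; push_cast at this; linarith
    have h2 := (hpmem N (i + 1) hi).2
    have e : d N * (i : ℝ) + d N = d N * ((i + 1 : ℕ) : ℝ) := by push_cast; ring
    simp only [hg, hl, hfl, e, min_eq_left h2]
  have hFint : ∀ s ∈ Icc 0 t, IntegrableOn (fun r => F r s) (Ioc 0 t) := fun s hs => by
    refine Integrable.of_bound (hmeas s hs) C ?_
    filter_upwards [ae_restrict_mem measurableSet_Ioc] with r hr
    exact hbd r (Ioc_subset_Icc_self hr) s hs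
  have hcellint : ∀ N i : ℕ, i < N + 1 →
      IntervalIntegrable (g N) volume (d N * (i : ℝ)) (d N * ((i + 1 : ℕ) : ℝ)) := by
    intro N i hi
    have hle : d N * (i : ℝ) ≤ d N * ((i + 1 : ℕ) : ℝ) :=
      mul_le_mul_of_nonneg_left (by push_cast; linarith) (hdpos N).le
    rw [intervalIntegrable_iff_integrableOn_Ioo_of_le hle]
    refine IntegrableOn.congr_fun ?_ (fun r hr => (hgcell N i hi r hr).symm) measurableSet_Ioo
    have hsub : Ioo (d N * (i : ℝ)) (d N * ((i + 1 : ℕ) : ℝ)) ⊆ Ioc 0 t := fun r hr =>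
      ⟨(hpmem N i hi.le).1.trans_lt hr.1, hr.2.le.trans (hpmem N (i + 1) hi).2⟩
    exact ((hFint _ (hpmem N i hi.le)).add (hFint _ (hpmem N (i + 1) hi))).mono_set hsub
  have hint : ∀ N, IntervalIntegrable (g N) volume 0 t := fun N => by
    have := IntervalIntegrable.trans_iterate (n := N + 1) (a := fun i : ℕ => d N * (i : ℝ))
      fun i hi => hcellint N i hi
    simpa only [Nat.cast_zero, mul_zero, hdN] using this
  have hsum : ∀ N, ∫ r in (0 : ℝ)..t, g N r = G t - G 0 := fun N => by
    have h1 := intervalIntegral.sum_integral_adjacent_intervals (n := N + 1)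
      (a := fun i : ℕ => d N * (i : ℝ)) fun i hi => hcellint N i hi
    simp only [Nat.cast_zero, mul_zero, hdN] at h1
    rw [← h1]
    have h2 := Finset.sum_range_sub (fun i : ℕ => G (d N * (i : ℝ))) (N + 1)
    simp only [Nat.cast_zero, mul_zero, hdN] at h2
    rw [← h2]
    refine Finset.sum_congr rfl fun i hi => ?_
    have hi' := Finset.mem_range.1 hi
    have hle : d N * (i : ℝ) ≤ d N * ((i + 1 : ℕ) : ℝ) :=
      mul_le_mul_of_nonneg_left (by push_cast; linarith) (hdpos N).le
    rw [hG _ (hpmem N i hi'.le) _ (hpmem N (i + 1) hi') hle,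
      intervalIntegral.integral_of_le hle, intervalIntegral.integral_of_le hle,
      integral_Ioc_eq_integral_Ioo, integral_Ioc_eq_integral_Ioo]
    exact setIntegral_congr_fun measurableSet_Ioo (hgcell N i hi')
  have hlmem : ∀ N, ∀ r ∈ Icc 0 t, l N r ∈ Icc 0 t := fun N r hr =>
    ⟨by have := hdpos N; positivity, (abs_mul_floor_sub_le (hdpos N) hr.1).1.trans hr.2⟩
  have humem : ∀ N, ∀ r ∈ Icc 0 t, min (l N r + d N) t ∈ Icc 0 t := fun N r hr =>
    ⟨le_min (add_nonneg (hlmem N r hr).1 (hdpos N).le) ht, min_le_right _ _⟩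
  -- Both cell endpoints tend to `r`, so continuity of `F r` yields the diagonal pointwise, and `C`
  -- dominates.
  have hlim : Tendsto (fun N => ∫ r in (0 : ℝ)..t, g N r) atTop
      (𝓝 (∫ r in (0 : ℝ)..t, 2 * F r r)) := by
    refine intervalIntegral.tendsto_integral_filter_of_dominated_convergence (fun _ => 2 * C)
      (Eventually.of_forall fun N => (hint N).def'.aestronglyMeasurable)
      (Eventually.of_forall fun N => ae_of_all _ fun r hr => ?_) (by simp)
      (ae_of_all _ fun r hr => ?_)
    · rw [uIoc_of_le ht] at hr
      have hr' := Ioc_subset_Icc_self hr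
      refine (abs_add_le _ _).trans ?_
      linarith [hbd r hr' _ (hlmem N r hr'), hbd r hr' _ (humem N r hr')]
    · rw [uIoc_of_le ht] at hr
      have hr' := Ioc_subset_Icc_self hr
      have hll : Tendsto (fun N => l N r) atTop (𝓝 r) := by
        refine tendsto_of_tendsto_of_tendsto_of_le_of_le (g := fun N => r - d N) (h := fun _ => r)
          (by simpa using hdlim.const_sub r) tendsto_const_nhds (fun N => ?_) (fun N => ?_)
        · have := (abs_mul_floor_sub_le (hdpos N) hr'.1).2
          simp only [hl]; linarith
        · exact (abs_mul_floor_sub_le (hdpos N) hr'.1).1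
      have hlu : Tendsto (fun N => min (l N r + d N) t) atTop (𝓝 r) := by
        have := (hll.add hdlim).min (tendsto_const_nhds (x := t))
        simpa [hr'.2] using this
      have hc := hcont r hr' r hr'
      have h1 := hc.tendsto.comp (tendsto_nhdsWithin_iff.2
        ⟨hll, Eventually.of_forall fun N => hlmem N r hr'⟩)
      have h2 := hc.tendsto.comp (tendsto_nhdsWithin_iff.2
        ⟨hlu, Eventually.of_forall fun N => humem N r hr'⟩)
      rw [two_mul]
      exact h1.add h2
  simp_rw [hsum] at hlim
  exact tendsto_nhds_unique tendsto_const_nhds hlim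

end Telescoping

/-! ### Even kernels and their rescaling. -/

section Kernels

lemma exists_even_kernel : ∃ K : E3 → ℝ, IsKernel K ∧ (∀ y, K (-y) = K y) ∧
    tsupport K ⊆ Metric.closedBall 0 (1 / 4) ∧ ∫ y, K y = 1 := by
  let φ : ContDiffBump (0 : E3) := ⟨1 / 8, 1 / 4, by norm_num, by norm_num⟩
  exact ⟨φ.normed volume, ⟨φ.contDiff_normed, φ.hasCompactSupport_normed⟩, φ.normed_neg,
    φ.tsupport_normed_eq.subset, φ.integral_normed⟩

/-- The rescaled kernel `ε⁻³ K(·/ε)`. -/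
def rescale (K : E3 → ℝ) (ε : ℝ) (y : E3) : ℝ := (ε ^ 3)⁻¹ * K (ε⁻¹ • y)

variable {K : E3 → ℝ} {ε : ℝ}

lemma tsupport_rescale (hs : tsupport K ⊆ Metric.closedBall 0 (1 / 4)) (hε : 0 < ε) :
    tsupport (rescale K ε) ⊆ Metric.closedBall 0 (ε / 4) := by
  refine closure_minimal (fun y hy => ?_) Metric.isClosed_closedBall
  have h1 : K (ε⁻¹ • y) ≠ 0 := fun h => hy (by simp [rescale, h])
  have h2 := hs (subset_tsupport K h1)
  rw [mem_closedBall_zero_iff, norm_smul, norm_inv, Real.norm_of_nonneg hε.le,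
    inv_mul_le_iff₀ hε] at h2
  rw [mem_closedBall_zero_iff]
  linarith

lemma IsKernel.rescale (hK : IsKernel K) (hs : tsupport K ⊆ Metric.closedBall 0 (1 / 4))
    (hε : 0 < ε) : IsKernel (rescale K ε) where
  smooth := contDiff_const.mul (hK.smooth.comp (contDiff_const_smul _))
  compact := (isCompact_closedBall (0 : E3) (ε / 4)).of_isClosed_subset (isClosed_tsupport _)
    (tsupport_rescale hs hε)

lemma fderiv_rescale (hK : IsKernel K) (y : E3) :
    fderiv ℝ (rescale K ε) y = ((ε ^ 3)⁻¹ * ε⁻¹) • fderiv ℝ K (ε⁻¹ • y) := by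
  have hd : Differentiable ℝ K := hK.smooth.differentiable (by simp)
  have h1 := fderiv_comp_smul (f := K) (x := y) (ε⁻¹ : ℝ)
  have h2 := fderiv_const_mul (𝕜 := ℝ) (a := fun y => K (ε⁻¹ • y)) (x := y)
    ((hd.comp (differentiable_id.const_smul ε⁻¹)) y) (ε ^ 3)⁻¹
  rw [show EMHD.rescale K ε = fun y => (ε ^ 3)⁻¹ * K (ε⁻¹ • y) from rfl, h2, h1, smul_smul]

/-- The rescaled gradient is at most C ε⁻⁴ and vanishes off the ball of radius ε, whose volume is ε³
|B₁|; one power ε⁻¹ remains in front of the average. -/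
lemma lintegral_fderiv_rescale_le (hK : IsKernel K)
    (hs : tsupport K ⊆ Metric.closedBall 0 (1 / 4)) {C : ℝ} (hC : ∀ y, ‖fderiv ℝ K y‖ ≤ C)
    (hε : 0 < ε) (g : E3 → ENNReal) :
    ∫⁻ y, ‖fderiv ℝ (rescale K ε) y‖ₑ * g y
      ≤ ENNReal.ofReal (C / ε) * volume (Metric.ball (0 : E3) 1)
        * laverage (volume.restrict (Metric.ball (0 : E3) ε)) g := by
  have hC0 : 0 ≤ C := (norm_nonneg _).trans (hC 0)
  have h1 : ∀ y, ‖fderiv ℝ (rescale K ε) y‖ₑ * g y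
      ≤ (Metric.ball (0 : E3) ε).indicator
        (fun y => ENNReal.ofReal (C * ((ε ^ 3)⁻¹ * ε⁻¹)) * g y) y := by
    intro y
    by_cases hy : y ∈ Metric.ball (0 : E3) ε
    · rw [indicator_of_mem hy]
      gcongr
      rw [← ofReal_norm, fderiv_rescale hK, norm_smul, Real.norm_of_nonneg (by positivity), mul_comm]
      exact ENNReal.ofReal_le_ofReal (mul_le_mul_of_nonneg_right (hC _) (by positivity))
    · have : fderiv ℝ (rescale K ε) y = 0 := by
        by_contra h
        have := tsupport_rescale hs hε (support_fderiv_subset ℝ h)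
        rw [mem_closedBall_zero_iff] at this
        rw [mem_ball_zero_iff] at hy
        linarith
      rw [this, indicator_of_notMem hy, ← ofReal_norm, norm_zero]
      simp
  have hv0 : volume (Metric.ball (0 : E3) ε) ≠ 0 := (Metric.measure_ball_pos _ _ hε).ne'
  have hvt : volume (Metric.ball (0 : E3) ε) ≠ ⊤ := measure_ball_lt_top.ne
  refine (lintegral_mono h1).trans ?_
  rw [lintegral_indicator measurableSet_ball, lintegral_const_mul' _ _ ENNReal.ofReal_ne_top,
    setLAverage_eq]
  have hball : volume (Metric.ball (0 : E3) ε)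
      = ENNReal.ofReal (ε ^ 3) * volume (Metric.ball (0 : E3) 1) := by
    rw [Measure.addHaar_ball_of_pos _ _ hε]; simp
  have e : ENNReal.ofReal (C * ((ε ^ 3)⁻¹ * ε⁻¹)) * volume (Metric.ball (0 : E3) ε)
      = ENNReal.ofReal (C / ε) * volume (Metric.ball (0 : E3) 1) := by
    rw [hball, ← mul_assoc, ← ENNReal.ofReal_mul (by positivity)]
    congr 2
    field_simp
  rw [← e, mul_assoc, ENNReal.mul_div_cancel hv0 hvt]

end Kernels

/-! ### Convergence of mollified pairings. -/

section Translation

/-- The correlation of two square integrable functions is continuous. -/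
lemma continuous_correlation {f g : T3 → ℝ} (hf : MemLp f 2 volume) (hg : MemLp g 2 volume) :
    Continuous fun y : E3 => ∫ x, f x * g (x - toTorus y) := by
  let S : C(E3, C(T3, T3)) :=
    ContinuousMap.curry ⟨fun p : E3 × T3 => p.2 - toTorus p.1, by fun_prop⟩
  have hS : ∀ y, MeasurePreserving (S y) volume volume := fun y =>
    measurePreserving_sub_right volume (toTorus y)
  have hc : Continuous fun y => Lp.compMeasurePreserving (S y) (hS y) hg.toLp :=
    continuous_const.compMeasurePreservingLp S.continuous hS (by simp)
  have h2 : Continuous fun y => inner ℝ hf.toLp (Lp.compMeasurePreserving (S y) (hS y) hg.toLp) :=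
    continuous_const.inner hc
  refine h2.congr fun y => ?_
  rw [L2.inner_def]
  refine integral_congr_ae ?_
  filter_upwards [hf.coeFn_toLp, Lp.coeFn_compMeasurePreserving hg.toLp (hS y),
    (hS y).quasiMeasurePreserving.ae_eq_comp hg.coeFn_toLp] with x h1 h2 h3
  rw [h1, h2, h3]
  simp [mul_comm, S]

/-- By scaling the pairing is ∫ K(y) c(εy) dy, with c the correlation of `f` and `g`. Translations
are continuous in L², so c is continuous and the limit is c(0). -/
lemma tendsto_integral_mul_conv_rescale {K : E3 → ℝ} (hK : IsKernel K)
    (hs : tsupport K ⊆ Metric.closedBall 0 (1 / 4)) (h1 : ∫ y, K y = 1) {f g : T3 → ℝ}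
    (hf : MemLp f 2 volume) (hg : MemLp g 2 volume) :
    Tendsto (fun ε => ∫ x, f x * conv (rescale K ε) g x) (𝓝[>] 0) (𝓝 (∫ x, f x * g x)) := by
  have hc := continuous_correlation hf hg
  set c : E3 → ℝ := fun y => ∫ x, f x * g (x - toTorus y) with hcdef
  obtain ⟨M, hM⟩ := (isCompact_closedBall (0 : E3) 1).exists_bound_of_continuousOn hc.continuousOn
  have hlim : Tendsto (fun ε : ℝ => ∫ y, K y * c (ε • y)) (𝓝[>] 0) (𝓝 (∫ y, K y * c 0)) := by
    refine tendsto_integral_filter_of_dominated_convergence (fun y => ‖K y‖ * M) ?_ ?_ ?_ ?_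
    · exact Eventually.of_forall fun ε => (hK.continuous.mul
        (hc.comp (continuous_const_smul ε))).aestronglyMeasurable
    · filter_upwards [Ioo_mem_nhdsGT (show (0 : ℝ) < 1 by norm_num)] with ε hε
      refine ae_of_all _ fun y => ?_
      rw [norm_mul]
      by_cases hy : K y = 0
      · simp [hy]
      have hy2 := hs (subset_tsupport K hy)
      rw [mem_closedBall_zero_iff] at hy2
      refine mul_le_mul_of_nonneg_left (hM _ ?_) (norm_nonneg _)
      rw [mem_closedBall_zero_iff, norm_smul, Real.norm_of_nonneg hε.1.le]
      nlinarith [hε.1, hε.2, norm_nonneg y]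
    · exact (hK.continuous.integrable_of_hasCompactSupport hK.compact).norm.mul_const _
    · refine ae_of_all _ fun y => ?_
      have : Continuous fun ε : ℝ => K y * c (ε • y) := by fun_prop
      simpa using (this.tendsto 0).mono_left nhdsWithin_le_nhds
  rw [integral_mul_const, h1, one_mul] at hlim
  have e0 : c 0 = ∫ x, f x * g x := by simp [hcdef]
  rw [e0] at hlim
  refine hlim.congr' ?_
  filter_upwards [self_mem_nhdsWithin] with ε hε
  have hε' : (0 : ℝ) < ε := hε
  have hKε := hK.rescale hs hε'
  rw [integral_mul_conv_eq hKε.continuous hKε.compact hf hg]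
  have h3 := Measure.integral_comp_inv_smul_of_nonneg (volume : Measure E3)
    (fun y => K y * c (ε • y)) hε'.le
  simp only [smul_smul, mul_inv_cancel₀ hε'.ne', one_smul, finrank_euclideanSpace,
    Fintype.card_fin, smul_eq_mul] at h3
  simp only [rescale, mul_assoc, integral_const_mul]
  rw [h3]
  field_simp

end Translation

/-! ### Balance of mollified helicity and the flux estimate. -/

section Helicity

variable {T : ℝ} {h H : ℝ → T3 → E3} {K : E3 → ℝ}

/-- ∫ curl U · K∗V = ∫ U · K∗curl V = ∫ K∗U · curl V: the curl is self-adjoint and commutes with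
`K`, and convolution with an even kernel is symmetric. -/
lemma IsCurlInv.integral_inner_vconv_comm (hK : IsKernel K) (he : ∀ y, K (-y) = K y)
    {u v U V : T3 → E3} (hv : MemLp v 2 volume)
    (hU : IsCurlInv U u) (hV : IsCurlInv V v) :
    ∫ x, inner ℝ (u x) (vconv K V x) = ∫ x, inner ℝ (v x) (vconv K U x) := by
  have hvi := hv.integrable (by norm_num)
  have hUi := hU.divFree.1
  rw [hU.curl_eq.2.2 _ (hK.vconv_smooth hV.divFree.1), hK.curl_vconv hV.curl_eq]
  simp only [inner_eq_sum, vconv_apply]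
  rw [integral_finsetSum _ fun i _ => hK.integrable_mul_conv (hUi.eval_piLp i) (hvi.eval_piLp i),
    integral_finsetSum _ fun i _ => hK.integrable_mul_conv (hvi.eval_piLp i) (hUi.eval_piLp i)]
  refine Finset.sum_congr rfl fun i _ => ?_
  rw [integral_mul_conv_comm hK.continuous hK.compact he (hU.memLp.eval_piLp i) (hv.eval_piLp i)]
  simp_rw [mul_comm (conv K _ _)]

/-- The balance of mollified helicity. -/
lemma IsWeakSolution.mollified_helicity_sub (hT : 0 < T) (hsol : IsWeakSolution T h)
    (hm : AEStronglyMeasurable (fun z : ℝ × T3 => h z.1 z.2) ((volume.restrict (Ioo 0 T)).prod volume))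
    (hK : IsKernel K) (he : ∀ y, K (-y) = K y) (hs : tsupport K ⊆ Metric.closedBall 0 (1 / 4))
    (hH : ∀ t ∈ Icc 0 T, IsCurlInv (H t) (h t)) {t : ℝ} (ht : t ∈ Icc 0 T) :
    (∫ x, inner ℝ (h t x) (vconv K (H t) x)) - ∫ x, inner ℝ (h 0 x) (vconv K (H 0) x)
      = ∫ r in (0 : ℝ)..t, 2 * flux K (h r) (h r) := by
  obtain ⟨M, hM⟩ := hsol.exists_energy_bound
  obtain ⟨C, hC⟩ := hK.exists_kernelDeriv_bound
  have hsub : Icc 0 t ⊆ Icc 0 T := Icc_subset_Icc_right ht.2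
  have hmeas : ∀ s ∈ Icc 0 t, AEStronglyMeasurable (fun r => flux K (h r) (h s))
      (volume.restrict (Ioc 0 t)) := fun s hs' => by
    have h1 := aestronglyMeasurable_flux hm hK ((hsol.memLp s (hsub hs')).integrable (by norm_num))
    rw [Measure.restrict_congr_set Ioo_ae_eq_Ioc] at h1
    exact h1.mono_measure (Measure.restrict_mono (Ioc_subset_Ioc_right ht.2) le_rfl)
  have hbd : ∀ r ∈ Icc 0 t, ∀ s ∈ Icc 0 t, |flux K (h r) (h s)| ≤ 9 * (M * (C * (1 + M))) :=
    fun r hr s hs' => abs_flux_le hK hs hC (hsol.memLp r (hsub hr)) (hsol.memLp s (hsub hs'))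
      (hM r (hsub hr)) (hM s (hsub hs'))
  have hint : ∀ a ∈ Icc 0 t, ∀ b ∈ Icc 0 t, a ≤ b → ∀ s ∈ Icc 0 t,
      IntervalIntegrable (fun r => flux K (h r) (h s)) volume a b := fun a ha b hb hab s hs' => by
    rw [intervalIntegrable_iff_integrableOn_Ioc_of_le hab]
    have : IntegrableOn (fun r => flux K (h r) (h s)) (Ioc 0 t) := by
      refine Integrable.of_bound (hmeas s hs') (9 * (M * (C * (1 + M)))) ?_
      filter_upwards [ae_restrict_mem measurableSet_Ioc] with r hr
      exact hbd r (Ioc_subset_Icc_self hr) s hs'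
    exact this.mono_set (Ioc_subset_Ioc ha.1 hb.2)
  refine sub_eq_integral_diagonal (G := fun t => ∫ x, inner ℝ (h t x) (vconv K (H t) x))
    (F := fun r s => flux K (h r) (h s)) ht.1 (fun a ha b hb hab => ?_) hmeas hbd
    fun r hr => (hsol.continuousOn_flux hK hs (hsol.memLp r (hsub hr))).mono hsub
  have ha' := hsub ha
  have hb' := hsub hb
  -- The increment of the quadratic form splits by polarisation: `hA` freezes the potential at `a`,
  -- `hB` at `b`, and the cross terms cancel by `hsym`.
  have hA := hsol.integral_sub_integral hT hm hK hs (hH a ha').divFree (hH a ha').curl_eq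
    (hsol.memLp a ha') ha' hb'
  have hB := hsol.integral_sub_integral hT hm hK hs (hH b hb').divFree (hH b hb').curl_eq
    (hsol.memLp b hb') ha' hb'
  have hsym := IsCurlInv.integral_inner_vconv_comm hK he (hsol.memLp b hb')
    (hH a ha') (hH b hb')
  rw [intervalIntegral.integral_add (hint a ha b hb hab a ha) (hint a ha b hb hab b hb), ← hA, ← hB]
  linarith

/-- Cubic integrability in space-time yields it on almost every time slice, enough to use the
increment identity under the time integral. -/
lemma MemLpBesovVMO.ae_memLp (hvmo : MemLpBesovVMO T 3 (1 / 3) 3 h)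
    (hL : ∀ t ∈ Icc 0 T, MemLp (h t) 2 volume) :
    ∀ᵐ t ∂(volume.restrict (Ioo 0 T)), MemLp (h t) 3 volume := by
  have hm : AEMeasurable (fun t => ∫⁻ x, ‖h t x‖ₑ ^ (3 : ℝ)) (volume.restrict (Ioo 0 T)) :=
    (hvmo.measurable.enorm.pow_const 3).lintegral_prod_right'
  have hlt := hvmo.norm_lt_top
  rw [show (3 : ℝ) / 3 = 1 by norm_num] at hlt
  simp only [ENNReal.rpow_one] at hlt
  filter_upwards [ae_lt_top' hm hlt.ne, ae_restrict_mem measurableSet_Ioo] with t ht ht'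
  refine ⟨(hL t (Ioo_subset_Icc_self ht')).1, ?_⟩
  rw [eLpNorm_lt_top_iff_lintegral_rpow_enorm_lt_top (by norm_num) (by norm_num)]
  simpa using ht

lemma vmoModulus_pow_three (h : ℝ → T3 → E3) (ε : ℝ) :
    vmoModulus T 3 3 h ε ^ 3 = ∫⁻ t in Ioo 0 T, ∫⁻ x,
      laverage (volume.restrict (Metric.ball (0 : E3) ε))
        (fun y => ‖h t x - h t (x - toTorus y)‖ₑ ^ 3) := by
  rw [vmoModulus, ← ENNReal.rpow_natCast, ← ENNReal.rpow_mul,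
    show (1 / 3 : ℝ) * ((3 : ℕ) : ℝ) = 1 by norm_num, ENNReal.rpow_one]
  simp only [show (3 : ℝ) / 3 = 1 by norm_num, ENNReal.rpow_one]
  congr! with t x y
  exact_mod_cast ENNReal.rpow_natCast _ 3

/-- The total flux through a rescaled kernel is controlled by the averaged modulus. -/
lemma IsWeakSolution.enorm_integral_flux_le (hsol : IsWeakSolution T h)
    (hvmo : MemLpBesovVMO T 3 (1 / 3) 3 h) (hK : IsKernel K) (he : ∀ y, K (-y) = K y)
    (hs : tsupport K ⊆ Metric.closedBall 0 (1 / 4)) {C : ℝ} (hC : ∀ y, ‖fderiv ℝ K y‖ ≤ C)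
    {ε : ℝ} (hε : 0 < ε) {t : ℝ} (ht : t ∈ Icc 0 T) :
    ‖∫ r in (0 : ℝ)..t, 2 * flux (rescale K ε) (h r) (h r)‖ₑ
      ≤ 2 * ENNReal.ofReal C * volume (Metric.ball (0 : E3) 1)
        * (ENNReal.ofReal (1 / ε ^ (1 / 3 : ℝ)) * vmoModulus T 3 3 h ε) ^ 3 := by
  have hKε := hK.rescale hs hε
  have heε : ∀ y, rescale K ε (-y) = rescale K ε y := fun y => by simp [rescale, he]
  have hC0 : 0 ≤ C := (norm_nonneg _).trans (hC 0)
  set V := volume (Metric.ball (0 : E3) 1) with hV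
  have hVt : V ≠ ⊤ := measure_ball_lt_top.ne
  have hcst : 2 * (ENNReal.ofReal (C / ε) * V) ≠ ⊤ :=
    ENNReal.mul_ne_top (by simp) (ENNReal.mul_ne_top ENNReal.ofReal_ne_top hVt)
  rw [intervalIntegral.integral_of_le ht.1]
  calc ‖∫ r in Ioc 0 t, 2 * flux (rescale K ε) (h r) (h r)‖ₑ
      ≤ ∫⁻ r in Ioc 0 t, ‖2 * flux (rescale K ε) (h r) (h r)‖ₑ := enorm_integral_le_lintegral_enorm _
    _ ≤ ∫⁻ r in Ioc 0 T, ‖2 * flux (rescale K ε) (h r) (h r)‖ₑ :=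
        lintegral_mono_set (Ioc_subset_Ioc_right ht.2)
    _ = ∫⁻ r in Ioo 0 T, ‖2 * flux (rescale K ε) (h r) (h r)‖ₑ := by
        rw [Measure.restrict_congr_set Ioo_ae_eq_Ioc]
    _ ≤ ∫⁻ r in Ioo 0 T, 2 * (ENNReal.ofReal (C / ε) * V) * ∫⁻ x,
          laverage (volume.restrict (Metric.ball (0 : E3) ε))
            (fun y => ‖h r x - h r (x - toTorus y)‖ₑ ^ 3) := by
        refine lintegral_mono_ae ?_
        filter_upwards [hvmo.ae_memLp hsol.memLp, ae_restrict_mem measurableSet_Ioo] with r hr hr'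
        have h1 := hKε.enorm_flux_le heε hr (hsol.divFree r (Ioo_subset_Icc_self hr'))
        have h2 : ‖(2 : ℝ)‖ₑ = 2 := by
          rw [← ofReal_norm]; norm_num
        rw [enorm_mul, h2, mul_assoc]
        gcongr
        refine h1.trans ?_
        rw [← lintegral_const_mul' _ _ (ENNReal.mul_ne_top ENNReal.ofReal_ne_top hVt)]
        exact lintegral_mono fun x => lintegral_fderiv_rescale_le hK hs hC hε _
    -- Here ε⁻¹ = (ε^(-1/3))³ is absorbed into the cubed modulus: the exponent 1/3 is critical.
    _ = 2 * ENNReal.ofReal C * V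
          * (ENNReal.ofReal (1 / ε ^ (1 / 3 : ℝ)) * vmoModulus T 3 3 h ε) ^ 3 := by
        rw [lintegral_const_mul' _ _ hcst, ← vmoModulus_pow_three, mul_pow,
          ← ENNReal.ofReal_pow (by positivity), div_pow, one_pow, ← Real.rpow_mul_natCast hε.le]
        norm_num
        rw [div_eq_mul_inv, ENNReal.ofReal_mul hC0]
        ring

lemma isWeakCurl_const (c : E3) : IsWeakCurl (fun _ => c) 0 := by
  refine ⟨integrable_const c, integrable_zero _ _ _, fun φ hφ => ?_⟩
  have hφi := isSmooth_iff.1 hφ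
  simp only [inner_eq_sum, Pi.zero_apply, PiLp.zero_apply, zero_mul, Finset.sum_const_zero,
    integral_zero]
  rw [integral_finsetSum _ fun i _ =>
    Integrable.mul_isSmooth (integrable_const (c i)) (isSmooth_iff.1 hφ.curl i)]
  refine (Finset.sum_eq_zero fun i _ => ?_).symm
  simp_rw [integral_const_mul, curl_apply]
  rw [integral_sub ((hφi _).partialDeriv _).integrable ((hφi _).partialDeriv _).integrable,
    integral_partialDeriv _ (hφi _), integral_partialDeriv _ (hφi _)]
  simp

lemma isWeaklyDivFree_const (c : E3) : IsWeaklyDivFree fun _ => c := by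
  refine ⟨integrable_const c, fun ψ hψ => ?_⟩
  simp only [inner_eq_sum, gradient_apply]
  rw [integral_finsetSum _ fun i _ =>
    Integrable.mul_isSmooth (integrable_const (c i)) (hψ.partialDeriv i)]
  refine Finset.sum_eq_zero fun i _ => ?_
  rw [integral_const_mul, integral_partialDeriv _ hψ, mul_zero]

/-- The mean of a weak solution is conserved. -/
lemma IsWeakSolution.integral_eq (hT : 0 < T) (hsol : IsWeakSolution T h)
    (hm : AEStronglyMeasurable (fun z : ℝ × T3 => h z.1 z.2) ((volume.restrict (Ioo 0 T)).prod volume))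
    {t : ℝ} (ht : t ∈ Icc 0 T) : ∫ x, h t x = ∫ x, h 0 x := by
  obtain ⟨K, hK, -, hs, h1⟩ := exists_even_kernel
  have h0 : (0 : ℝ) ∈ Icc 0 T := ⟨le_rfl, hT.le⟩
  refine ext_inner_right ℝ fun c => ?_
  have hint := fun s hs => (hsol.memLp s hs).integrable (q := 2) (by norm_num)
  have hc : ∀ x, vconv K (fun _ => c) x = c := fun x => by
    ext k
    simp [conv, integral_mul_const, h1]
  have hflux : ∀ r, flux K (h r) 0 = 0 := fun r => by simp [flux, conv]
  have hinner : ∀ s ∈ Icc 0 T, inner ℝ (∫ x, h s x) c = ∫ x, inner ℝ (h s x) c := fun s hs' => by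
    rw [real_inner_comm, ← integral_inner (hint s hs')]
    simp_rw [real_inner_comm]
  -- A constant field is unchanged by a kernel of mass one and has zero curl, so no flux appears.
  have := hsol.integral_sub_integral hT hm hK hs (isWeaklyDivFree_const c) (isWeakCurl_const c)
    MemLp.zero h0 ht
  simp only [hc, hflux, intervalIntegral.integral_zero] at this
  rw [hinner t ht, hinner 0 h0]
  linarith

end Helicity

end EMHD

end

theorem theorem1p2
    (T : ℝ) (hT : 0 < T)
    (h j : ℝ → EMHD.T3 → EMHD.E3)
    (hsol : EMHD.IsWeakSolution T h)
    (hmean : ∫ x, h 0 x = 0)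
    (hcurl : ∀ t ∈ Icc 0 T, EMHD.IsWeakCurl (h t) (j t))
    (hj : EMHD.IsContinuousInLp T (3 / 2) j)
    (hvmo : EMHD.MemLpBesovVMO T 3 (1 / 3) 3 h) :
    (∀ t ∈ Icc 0 T, ∃ H : EMHD.T3 → EMHD.E3, EMHD.IsCurlInv H (h t)) ∧
    ∀ H : ℝ → EMHD.T3 → EMHD.E3, (∀ t ∈ Icc 0 T, EMHD.IsCurlInv (H t) (h t)) →
      ∀ t ∈ Icc 0 T,
        Integrable (fun x => inner ℝ (H t x) (h t x)) ∧
        ∫ x, inner ℝ (H t x) (h t x) = ∫ x, inner ℝ (H 0 x) (h 0 x) := by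
  have hm := hvmo.measurable
  refine ⟨fun t ht => EMHD.exists_isCurlInv (hsol.memLp t ht) (hsol.divFree t ht)
    ((hsol.integral_eq hT hm ht).trans hmean), fun H hH t ht => ?_⟩
  have h0 : (0 : ℝ) ∈ Icc 0 T := ⟨le_rfl, hT.le⟩
  refine ⟨EMHD.integrable_inner_of_memLp (hH t ht).memLp (hsol.memLp t ht), ?_⟩
  obtain ⟨K, hK, he, hs, h1⟩ := EMHD.exists_even_kernel
  obtain ⟨C, hC⟩ := (hK.compact.fderiv ℝ).exists_bound_of_continuous
    (hK.smooth.continuous_fderiv (by simp))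
  have hlim : ∀ s ∈ Icc 0 T, Tendsto
      (fun ε => ∫ x, inner ℝ (h s x) (EMHD.vconv (EMHD.rescale K ε) (H s) x)) (𝓝[>] 0)
      (𝓝 (∫ x, inner ℝ (H s x) (h s x))) := by
    intro s hs'
    have hL := hsol.memLp s hs'
    have hHL := (hH s hs').memLp
    have e : ∫ x, inner ℝ (H s x) (h s x) = ∑ i, ∫ x, h s x i * H s x i := by
      simp_rw [EMHD.inner_eq_sum, mul_comm (H s _ _)]
      exact integral_finsetSum _ fun i _ => (hL.eval_piLp i).integrable_mul (hHL.eval_piLp i)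
    rw [e]
    refine (tendsto_finsetSum _ fun i _ => EMHD.tendsto_integral_mul_conv_rescale hK hs h1
      (hL.eval_piLp i) (hHL.eval_piLp i)).congr' ?_
    filter_upwards [self_mem_nhdsWithin] with ε hε
    simp only [EMHD.inner_eq_sum, EMHD.vconv_apply]
    exact (integral_finsetSum _ fun i _ => (hK.rescale hs hε).integrable_mul_conv
      ((hL.integrable (by norm_num)).eval_piLp i) ((hHL.integrable (by norm_num)).eval_piLp i)).symm
  have hdiff := (hlim t ht).sub (hlim 0 h0)
  have hbound : Tendsto (fun ε : ℝ => 2 * ENNReal.ofReal C * volume (Metric.ball (0 : EMHD.E3) 1)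
      * (ENNReal.ofReal (1 / ε ^ (1 / 3 : ℝ)) * EMHD.vmoModulus T 3 3 h ε) ^ 3) (𝓝[>] 0) (𝓝 0) := by
    have h2 := ENNReal.Tendsto.const_mul (a := 2 * ENNReal.ofReal C
      * volume (Metric.ball (0 : EMHD.E3) 1)) ((ENNReal.continuous_pow 3).tendsto 0 |>.comp hvmo.vmo)
      (Or.inr (ENNReal.mul_ne_top (ENNReal.mul_ne_top (by simp) ENNReal.ofReal_ne_top)
        measure_ball_lt_top.ne))
    simpa using h2
  have hzero : Tendsto (fun ε =>
      (∫ x, inner ℝ (h t x) (EMHD.vconv (EMHD.rescale K ε) (H t) x))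
        - ∫ x, inner ℝ (h 0 x) (EMHD.vconv (EMHD.rescale K ε) (H 0) x)) (𝓝[>] 0) (𝓝 0) := by
    rw [tendsto_zero_iff_enorm_tendsto_zero]
    refine tendsto_of_tendsto_of_tendsto_of_le_of_le' tendsto_const_nhds hbound
      (Eventually.of_forall fun _ => zero_le) ?_
    -- For ε < 1 the rescaled support stays in the ball of radius 1/4, hence in one fundamental
    -- cube.
    filter_upwards [Ioo_mem_nhdsGT (show (0 : ℝ) < 1 by norm_num)] with ε hε
    have hs' : tsupport (EMHD.rescale K ε) ⊆ Metric.closedBall 0 (1 / 4) :=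
      (EMHD.tsupport_rescale hs hε.1).trans (Metric.closedBall_subset_closedBall (by linarith [hε.2]))
    rw [hsol.mollified_helicity_sub hT hm (hK.rescale hs hε.1)
      (fun y => by simp [EMHD.rescale, he]) hs' hH ht]
    exact hsol.enorm_integral_flux_le hvmo hK he hs hC hε.1 ht
  exact sub_eq_zero.1 (tendsto_nhds_unique hdiff hzero)
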